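/- Let $m\ge 1$, $n=2m+1$, and let the odd polygon state space $\mathcal S_n\subset\mathbb R^3$ be the convex hull of the points $s_k=\big(\sec(\tfrac{\pi}{n})\cos(\tfrac{2k\pi}{n}),\ \sec(\tfrac{\pi}{n})\sin(\tfrac{2k\pi}{n}),\ 1\big)$, $k=1,\dots,n$. An effect is an affine function $e:\mathcal S_n\to[0,1]$; a nonzero effect $e$ is indecomposable if $e=e_1+e_2$ with effects $e_1,e_2$ is possible only when $e_1,e_2$ are scalar multiples of $e$. An observable $A$ is a finite family of effects $(A_x)_{x\in X}$ with $\sum_x A_x=1$; it is dichotomic (trichotomic) if $X$ has two (three) elements, and indecomposable if all its nonzero effects are. $B$ is a postprocessing of $A$ if $B_y=\sum_x\nu_{xy}A_x$ for a matrix $\nu$ with entries in $[0,1]$ and $\sum_y\nu_{xy}=1$ for all $x$; $A$ and $B$ are equivalent, $A\leftrightarrow B$, if each is a postprocessing of the other. For a set $\mathcal B$ of observables, $\mathrm{sim}(\mathcal B)$ is the set of the observables $A$ of the form $A_y=\sum_{i}\sum_{x}\nu_{(i,x)y}\,p_i\,B^{(i)}_x$ with finitely many $B^{(i)}\in\mathcal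 B$, a probability distribution $(p_i)$, and $\nu_{(i,x)y}\in[0,1]$, $\sum_y\nu_{(i,x)y}=1$. An observable $A$ is simulation irreducible if $A\in\mathrm{sim}(\mathcal B)$ implies $A\leftrightarrow B$ for some $B\in\mathcal B$, for every set $\mathcal B$ of observables. The minimal simulation number of a set $\mathcal A$ of observables is the least cardinality of a set $\mathcal B$ with $\mathcal A\subseteq\mathrm{sim}(\mathcal B)$ ($\infty$ if there is no finite such $\mathcal B$). Let $g_k=\frac{1}{1+\sec(\pi/n)}\big(-\cos(\tfrac{(2k-1)\pi}{n}),\,-\sin(\tfrac{(2k-1)\pi}{n}),\,1\big)$, $k=1,\dots,n$, also regarded as the functions $s\mapsto g_k\cdot s$ on $\mathcal S_n$. These points are the vertices of a regular $n$-gon with center $\frac{1}{1+\sec(\pi/n)}(0,0,1)$. Call a three-element set $T\subseteq\{1,\dots,n\}$ central if the triangle with vertices $g_k$, $k\in T$, contains this center, and say that an observable $A$ is supported on $T$ if its outcomes are in bijection with $T$ such that the effect corresponding to $k\in T$ is a positive multiple of $g_k$. Then: (1) The minimal simulation number of the set of all observables on $\mathcal S_{2m+1}$ is $\frac16 m(m+1)(2m+1)$.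 (2) There is no indecomposable dichotomic observable on $\mathcal S_{2m+1}$. (3) A trichotomic observable on $\mathcal S_{2m+1}$ is simulation irreducible if and only if it is supported on some central set $T$. Every central $T$ supports an observable, and observables supported on central sets $T$ and $T'$ are equivalent if and only if $T=T'$. The number of central sets is $\frac16m(m+1)(2m+1)$, and so is the number of equivalence classes of trichotomic simulation irreducible observables. -/

import Mathlib

namespace GPT

noncomputable section

/-- `e` is an effect on the convex state space `S`: an affine (convex-combination preserving)
function `S → ℝ` with values in `[0, 1]`. -/
def IsEffect {V : Type*} [AddCommGroup V] [Module ℝ V] (S : Set V) (e : S → ℝ) : Prop :=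
  (∀ s, 0 ≤ e s ∧ e s ≤ 1) ∧
  ∀ (p : ℝ) (s t r : S), 0 ≤ p → p ≤ 1 → (r : V) = p • (s : V) + (1 - p) • (t : V) →
    e r = p * e s + (1 - p) * e t

/-- A nonzero effect is indecomposable if whenever it is a sum of two effects, both of them are
scalar multiples of it. -/
def IsIndecomposableEffect {V : Type*} [AddCommGroup V] [Module ℝ V] (S : Set V)
    (e : S → ℝ) : Prop :=
  IsEffect S e ∧ e ≠ 0 ∧
  ∀ e₁ e₂ : S → ℝ, IsEffect S e₁ → IsEffect S e₂ → e = e₁ + e₂ →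
    (∃ a : ℝ, e₁ = a • e) ∧ (∃ b : ℝ, e₂ = b • e)

/-- An observable on `S` with a finite outcome set: a family of effects summing up to the unit
effect. -/
structure Observable {V : Type*} [AddCommGroup V] [Module ℝ V] (S : Set V) where
  Outcome : Type
  [fintypeOutcome : Fintype Outcome]
  effect : Outcome → S → ℝ
  isEffect : ∀ x, IsEffect S (effect x)
  sum_effect : ∑ x, effect x = 1

attribute [instance] Observable.fintypeOutcome

/-- A stochastic matrix (classical channel) from `X` to `Y`; `ν x y` is the probability that the
outcome `x` is mapped to the outcome `y`. -/
def IsStochastic {X Y : Type} [Fintype Y] (ν : X → Y → ℝ) : Prop :=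
  (∀ x y, 0 ≤ ν x y ∧ ν x y ≤ 1) ∧ ∀ x, ∑ y, ν x y = 1

namespace Observable

/-- All nonzero effects of the observable are indecomposable. -/
def IsIndecomposable {V : Type*} [AddCommGroup V] [Module ℝ V] {S : Set V}
    (A : Observable S) : Prop :=
  ∀ x, A.effect x ≠ 0 → IsIndecomposableEffect S (A.effect x)

/-- `A → B`: the observable `B` is a postprocessing of `A`. -/
def PostprocessesTo {V : Type*} [AddCommGroup V] [Module ℝ V] {S : Set V}
    (A B : Observable S) : Prop :=
  ∃ ν : A.Outcome → B.Outcome → ℝ, IsStochastic ν ∧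
    ∀ y, B.effect y = ∑ x, ν x y • A.effect x

/-- `A ↔ B`: postprocessing equivalence. -/
def PostEquiv {V : Type*} [AddCommGroup V] [Module ℝ V] {S : Set V}
    (A B : Observable S) : Prop :=
  A.PostprocessesTo B ∧ B.PostprocessesTo A

theorem PostprocessesTo.refl {V : Type*} [AddCommGroup V] [Module ℝ V] {S : Set V}
    (A : Observable S) : A.PostprocessesTo A := by
  classical
  refine ⟨fun x y => if x = y then 1 else 0, ⟨fun x y => ?_, fun x => ?_⟩, fun y => ?_⟩
  · dsimp only
    split_ifs <;> norm_num
  · simp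
  · simp [ite_smul]

theorem PostprocessesTo.trans {V : Type*} [AddCommGroup V] [Module ℝ V] {S : Set V}
    {A B C : Observable S} (h₁ : A.PostprocessesTo B) (h₂ : B.PostprocessesTo C) :
    A.PostprocessesTo C := by
  obtain ⟨ν, hν, hB⟩ := h₁
  obtain ⟨μ, hμ, hC⟩ := h₂
  have h0 : ∀ x z, 0 ≤ ∑ y, ν x y * μ y z := fun x z =>
    Finset.sum_nonneg fun y _ => mul_nonneg (hν.1 x y).1 (hμ.1 y z).1
  have h1 : ∀ x, ∑ z, ∑ y, ν x y * μ y z = 1 := by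
    intro x
    rw [Finset.sum_comm]
    simp_rw [← Finset.mul_sum, hμ.2, mul_one]
    exact hν.2 x
  refine ⟨fun x z => ∑ y, ν x y * μ y z, ⟨fun x z => ⟨h0 x z, ?_⟩, h1⟩, fun z => ?_⟩
  · rw [← h1 x]
    exact Finset.single_le_sum (f := fun z => ∑ y, ν x y * μ y z)
      (fun z _ => h0 x z) (Finset.mem_univ z)
  · rw [hC z]
    simp_rw [hB, Finset.smul_sum, Finset.sum_smul, smul_smul]
    rw [Finset.sum_comm]
    simp_rw [mul_comm]

/-- Postprocessing equivalence as an equivalence relation on the set of all observables. -/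
def postSetoid {V : Type*} [AddCommGroup V] [Module ℝ V] (S : Set V) :
    Setoid (Observable S) where
  r := PostEquiv
  iseqv :=
    { refl := fun A => ⟨PostprocessesTo.refl A, PostprocessesTo.refl A⟩
      symm := fun h => ⟨h.2, h.1⟩
      trans := fun h₁ h₂ => ⟨h₁.1.trans h₂.1, h₂.2.trans h₁.2⟩ }

/-- The number of pairwise postprocessing inequivalent observables in `P`: the number of
equivalence classes that meet `P`. -/
def numInequivalent {V : Type*} [AddCommGroup V] [Module ℝ V] {S : Set V}
    (P : Set (Observable S)) : ℕ∞ :=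
  (Quotient.mk (postSetoid S) '' P).encard

/-- `sim 𝓑`: the observables that can be simulated with finitely many observables of `𝓑`, by
measuring `B i` with probability `p i` and postprocessing the pair of `i` and the measured
outcome `x`. -/
def sim {V : Type*} [AddCommGroup V] [Module ℝ V] {S : Set V}
    (𝓑 : Set (Observable S)) : Set (Observable S) :=
  {A | ∃ (N : ℕ) (B : Fin N → Observable S) (p : Fin N → ℝ)
      (ν : (Σ i, (B i).Outcome) → A.Outcome → ℝ),
      (∀ i, B i ∈ 𝓑) ∧ (∀ i, 0 ≤ p i) ∧ ∑ i, p i = 1 ∧ IsStochastic ν ∧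
      ∀ y, A.effect y = ∑ i, ∑ x, (ν ⟨i, x⟩ y * p i) • (B i).effect x}

/-- An observable is simulation irreducible if any set that simulates it contains an observable
that is postprocessing equivalent to it. -/
def IsSimIrreducible {V : Type*} [AddCommGroup V] [Module ℝ V] {S : Set V}
    (A : Observable S) : Prop :=
  ∀ 𝓑 : Set (Observable S), A ∈ sim 𝓑 → ∃ B ∈ 𝓑, A.PostEquiv B

/-- The minimal simulation number of a set of observables: the least cardinality of a set that
simulates all of them (`⊤` if no finite set does). -/
def minSimNumber {V : Type*} [AddCommGroup V] [Module ℝ V] {S : Set V}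
    (𝓐 : Set (Observable S)) : ℕ∞ :=
  ⨅ (𝓑 : Set (Observable S)) (_ : 𝓐 ⊆ sim 𝓑), 𝓑.encard

end Observable

open Real in
/-- The extremal states of the `n`-sided regular polygon, in the plane `z = 1` of `ℝ³`. -/
def polygonVertex (n k : ℕ) : Fin 3 → ℝ :=
  ![1 / cos (π / n) * cos (2 * k * π / n), 1 / cos (π / n) * sin (2 * k * π / n), 1]

/-- The polygon state space with `n` vertices. -/
def polygon (n : ℕ) : Set (Fin 3 → ℝ) :=
  convexHull ℝ (polygonVertex n '' Set.Icc 1 n)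

/-- The function `s ↦ v · s` on the polygon state space given by a vector `v` of `ℝ³`. -/
def dotEffect (n : ℕ) (v : Fin 3 → ℝ) : polygon n → ℝ :=
  fun s => v ⬝ᵥ (s : Fin 3 → ℝ)

open Real in
/-- The vectors `g k`, `k = 1, …, n`. They are the vertices of a regular `n`-gon (in a plane
`z = const` of `ℝ³`). -/
def gVec (n k : ℕ) : Fin 3 → ℝ :=
  (1 / (1 + 1 / cos (π / n))) •
    ![-cos ((2 * k - 1) * π / n), -sin ((2 * k - 1) * π / n), 1]

open Real in
/-- The center of the regular polygon with the vertices `g 1, …, g n`. -/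
def gCenter (n : ℕ) : Fin 3 → ℝ :=
  (1 / (1 + 1 / cos (π / n))) • ![0, 0, 1]

/-- The three-element sets `{k₁, k₂, k₃} ⊆ {1, …, n}` for which the triangle with vertices
`g k₁, g k₂, g k₃` contains the center of the polygon. -/
def centralTriangles (n : ℕ) : Set (Finset ℕ) :=
  {T | T ⊆ Finset.Icc 1 n ∧ T.card = 3 ∧
    gCenter n ∈ convexHull ℝ (gVec n '' (T : Set ℕ))}

/-- The outcomes of `A` are in bijection with the elements of `T`, and the effect of the outcome
that corresponds to `k ∈ T` is a positive multiple of `g k`. -/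
def IsSupportedOn {n : ℕ} (A : Observable (polygon n)) (T : Finset ℕ) : Prop :=
  ∃ (k : A.Outcome ≃ T) (c : A.Outcome → ℝ),
    ∀ x, 0 < c x ∧ A.effect x = c x • dotEffect n (gVec n (k x))

end

end GPT

/-!
On an odd polygon every effect is a nonnegative combination of the effects `g k`: if its minimum
over the vertices is `r`, then after subtracting `r` it vanishes at a vertex, and it is a
combination of the two `g k` that vanish there (`IsEffect.exists_eq_sum_gVec`). Each `g k` vanishes
along an edge, so it spans an extreme ray of the cone of nonnegative functions, and the
indecomposable effects are exactly the positive multiples of the `g k` that are effects.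

An observable with effects `c k • g k` amounts to nonnegative weights `c` with `∑ c k • g k = 1`,
that is, to a representation of the center of the polygon of the `g k` as a barycenter. Since `n` is
odd, the center is on no segment between two of them (`IsBalanced.three_le_card`): there is no
indecomposable dichotomic observable, and the weights on a central triangle are positive. They are
unique, because three of the `g k` are linearly independent. By Carathéodory's theorem the support
of any such `c` contains a central triangle; splitting off the largest possible multiple of its
weights and iterating shows that `c` is a mixture of weights of central triangles
(`exists_eq_sum_unitWeight`). So the observables on central triangles simulate all observables
(`mem_sim_range`).

Conversely, indecomposable linearly independent effects make an observable simulation irreducible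
(`Observable.isSimIrreducible_of_linearIndependent`), and an observable equivalent to one with
linearly independent effects contains multiples of all of them
(`Observable.PostEquiv.exists_injective_of_linearIndependent`). Hence the observables on central
triangles are irreducible, pairwise inequivalent for different triangles, and up to equivalence the
only irreducible ones; the minimal simulation number is the number of central triangles. A triangle
is central when each of its three arcs has at most `m` steps (`mem_centralTriangles_iff`), and these
are counted by `1 ^ 2 + ⋯ + m ^ 2`.
-/

namespace GPT

/-! ### Effects and observables on a general state space -/

section General

variable {V : Type*} [AddCommGroup V] [Module ℝ V] {S : Set V}

theorem IsEffect.smul {e : S → ℝ} (he : IsEffect S e) {a : ℝ} (h0 : 0 ≤ a) (h1 : a ≤ 1) :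
    IsEffect S (a • e) := by
  refine ⟨fun s => ?_, fun p s t r hp hp1 h => ?_⟩
  · have := he.1 s
    exact ⟨mul_nonneg h0 this.1, mul_le_one₀ h1 this.1 this.2⟩
  · simp only [Pi.smul_apply, smul_eq_mul, he.2 p s t r hp hp1 h]
    ring

theorem IsEffect.sub {e f : S → ℝ} (he : IsEffect S e) (hf : IsEffect S f) (h : f ≤ e) :
    IsEffect S (e - f) := by
  refine ⟨fun s => ?_, fun p s t r hp hp1 hr => ?_⟩
  · have h1 := he.1 s
    have h2 := hf.1 s
    have h3 := h s
    simp only [Pi.sub_apply]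
    constructor <;> linarith
  · simp only [Pi.sub_apply, he.2 p s t r hp hp1 hr, hf.2 p s t r hp hp1 hr]
    ring

/-- An effect below an indecomposable one is a multiple of it. -/
theorem IsIndecomposableEffect.eq_smul_of_le {e f : S → ℝ} (he : IsIndecomposableEffect S e)
    (hf : IsEffect S f) (h : f ≤ e) : ∃ a : ℝ, f = a • e :=
  (he.2.2 f (e - f) hf (he.1.sub hf h) (by simp)).1

namespace Observable

theorem exists_pos_of_effect_ne_zero (A : Observable S) {x : A.Outcome} (h : A.effect x ≠ 0) :
    ∃ s, 0 < A.effect x s := by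
  obtain ⟨s, hs⟩ := Function.ne_iff.1 h
  exact ⟨s, lt_of_le_of_ne ((A.isEffect x).1 s).1 (Ne.symm hs)⟩

/-- If `A` is simulated by observables `B i`, then by indecomposability every term
`ν (i, x) y • B i x` is a multiple `β x y • A y`. Linear independence forces `∑ x, β x y = 1`, so
for each single `i` of positive weight `β` is a stochastic matrix that turns `A` into `B i`, while
`ν (i, ·)` turns `B i` into `A`. -/
theorem isSimIrreducible_of_linearIndependent (A : Observable S) (hA : A.IsIndecomposable)
    (hli : LinearIndependent ℝ A.effect) : A.IsSimIrreducible := by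
  rintro 𝓑 ⟨N, B, p, ν, hB, hp0, hp1, hν, hsum⟩
  obtain ⟨i, hi⟩ : ∃ i, 0 < p i := by
    by_contra! h
    have : ∑ i, p i ≤ 0 := Finset.sum_nonpos fun i _ => h i
    linarith
  have hi1 : p i ≤ 1 := hp1 ▸ Finset.single_le_sum (fun j _ => hp0 j) (Finset.mem_univ i)
  have hpos : ∀ j x y s, 0 ≤ ((ν ⟨j, x⟩ y * p j) • (B j).effect x) s := fun j x y s =>
    mul_nonneg (mul_nonneg (hν.1 _ _).1 (hp0 j)) (((B j).isEffect x).1 s).1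
  have key : ∀ x y, ∃ b : ℝ, 0 ≤ b ∧ ν ⟨i, x⟩ y • (B i).effect x = b • A.effect y := by
    intro x y
    have hle : (ν ⟨i, x⟩ y * p i) • (B i).effect x ≤ A.effect y := by
      intro s
      rw [hsum y, Finset.sum_apply]
      refine le_trans ?_ (Finset.single_le_sum (f := fun j =>
        (∑ x, (ν ⟨j, x⟩ y * p j) • (B j).effect x) s) (fun j _ => ?_) (Finset.mem_univ i))
      · simp only [Finset.sum_apply]
        exact Finset.single_le_sum (f := fun x => ((ν ⟨i, x⟩ y * p i) • (B i).effect x) s)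
          (fun x _ => hpos i x y s) (Finset.mem_univ x)
      · simp only [Finset.sum_apply]
        exact Finset.sum_nonneg fun x _ => hpos j x y s
    obtain ⟨a, ha⟩ := (hA y (hli.ne_zero y)).eq_smul_of_le
      (((B i).isEffect x).smul (mul_nonneg (hν.1 ⟨i, x⟩ y).1 hi.le)
        (mul_le_one₀ (hν.1 ⟨i, x⟩ y).2 hi.le hi1)) hle
    obtain ⟨s, hs⟩ := A.exists_pos_of_effect_ne_zero (hli.ne_zero y)
    have ha0 : 0 ≤ a := by
      have h1 := hpos i x y s
      rw [ha, Pi.smul_apply, smul_eq_mul] at h1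
      exact nonneg_of_mul_nonneg_left h1 hs
    refine ⟨a / p i, div_nonneg ha0 hi.le, ?_⟩
    have h2 : ν ⟨i, x⟩ y • (B i).effect x
        = (p i)⁻¹ • ((ν ⟨i, x⟩ y * p i) • (B i).effect x) := by
      rw [smul_smul]
      congr 1
      field_simp
    rw [h2, ha, smul_smul]
    congr 1
    field_simp
  choose β hβ0 hβ using key
  have hβ1 : ∀ y, ∑ x, β x y = 1 := by
    have h0 : ∑ y, (∑ x, β x y - 1) • A.effect y = 0 := by
      simp only [sub_smul, one_smul, Finset.sum_sub_distrib, Finset.sum_smul, ← hβ]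
      rw [Finset.sum_comm, A.sum_effect]
      simp only [← Finset.sum_smul, hν.2, one_smul, (B i).sum_effect, sub_self]
    intro y
    linarith [Fintype.linearIndependent_iff.1 hli _ h0 y]
  refine ⟨B i, hB i, ⟨fun y x => β x y, ⟨fun y x => ⟨hβ0 x y, ?_⟩, hβ1⟩, fun x => ?_⟩,
    ⟨fun x y => ν ⟨i, x⟩ y, ⟨fun x y => hν.1 _ _, fun x => hν.2 _⟩, fun y => ?_⟩⟩
  · rw [← hβ1 y]
    exact Finset.single_le_sum (f := fun x => β x y) (fun x _ => hβ0 x y) (Finset.mem_univ x)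
  · simp only [← hβ, ← Finset.sum_smul, hν.2, one_smul]
  · simp only [hβ, ← Finset.sum_smul, hβ1, one_smul]

/-- An observable equivalent to one with linearly independent effects contains a positive multiple
of each of those: the two stochastic matrices compose to the identity. -/
theorem PostEquiv.exists_injective_of_linearIndependent {A B : Observable S}
    (h : A.PostEquiv B) (hli : LinearIndependent ℝ B.effect) :
    ∃ (f : B.Outcome → A.Outcome) (c : B.Outcome → ℝ), Function.Injective f ∧
      ∀ x, 0 < c x ∧ A.effect (f x) = c x • B.effect x := by
  classical
  obtain ⟨⟨μ, hμ, hB⟩, ⟨ν, hν, hA⟩⟩ := h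
  have hid : ∀ x x', ∑ y, μ y x * ν x' y = if x' = x then 1 else 0 := by
    intro x
    have h0 : ∑ x', (∑ y, μ y x * ν x' y - if x' = x then 1 else 0) • B.effect x' = 0 := by
      simp only [sub_smul, Finset.sum_sub_distrib, ite_smul, one_smul, zero_smul,
        Finset.sum_ite_eq', Finset.mem_univ, if_true, Finset.sum_smul]
      rw [Finset.sum_comm]
      simp only [mul_smul, ← Finset.smul_sum, ← hA, ← hB, sub_self]
    intro x'
    linarith [Fintype.linearIndependent_iff.1 hli _ h0 x']
  have hnn : ∀ x x' y, 0 ≤ μ y x * ν x' y := fun x x' y => mul_nonneg (hμ.1 _ _).1 (hν.1 _ _).1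
  have hex : ∀ x, ∃ y, 0 < μ y x * ν x y := by
    intro x
    by_contra! h
    have h1 := hid x x
    have h2 : ∑ y, μ y x * ν x y ≤ 0 := Finset.sum_nonpos fun y _ => h y
    rw [if_pos rfl] at h1
    linarith
  choose f hf using hex
  have hμf : ∀ x, 0 < μ (f x) x := fun x =>
    pos_of_mul_pos_left (hf x) (hν.1 _ _).1
  have hνf : ∀ x, 0 < ν x (f x) := fun x =>
    pos_of_mul_pos_right (hf x) (hμ.1 _ _).1
  have hzero : ∀ x x', x' ≠ x → ν x' (f x) = 0 := by
    intro x x' hne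
    have h1 := hid x x'
    rw [if_neg hne, Finset.sum_eq_zero_iff_of_nonneg fun y _ => hnn x x' y] at h1
    exact (mul_eq_zero.1 (h1 (f x) (Finset.mem_univ _))).resolve_left (hμf x).ne'
  refine ⟨f, fun x => ν x (f x), fun x x' hxx => ?_, fun x => ⟨hνf x, ?_⟩⟩
  · by_contra hne
    have h1 := hzero x' x hne
    rw [← hxx] at h1
    exact (hνf x).ne' h1
  · rw [hA (f x)]
    refine Finset.sum_eq_single x (fun x' _ hne => ?_) (fun h => absurd (Finset.mem_univ _) h)
    rw [hzero x x' hne, zero_smul]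

/-- A relabelling of the outcomes is a postprocessing. -/
theorem PostprocessesTo.of_equiv {A B : Observable S} (f : A.Outcome ≃ B.Outcome)
    (h : ∀ x, B.effect (f x) = A.effect x) : A.PostprocessesTo B := by
  classical
  refine ⟨fun x y => if f x = y then 1 else 0, ⟨fun x y => ?_, fun x => ?_⟩, fun y => ?_⟩
  · dsimp only
    split_ifs <;> norm_num
  · simp
  · obtain ⟨x, rfl⟩ := f.surjective y
    simp [ite_smul, h]

end Observable

end General

/-! ### Points on a circle -/

section Circle

open Real

/-- The point of `ℝ³` at height `1`, distance `|ρ|` from the axis and angle `α` (shifted by `π`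
for negative `ρ`). The states `polygonVertex` have this form with `ρ = sec (π / n)`, the vectors
`gVec` are multiples of such points with `ρ = -1`. -/
noncomputable def circlePt (ρ α : ℝ) : Fin 3 → ℝ := ![ρ * cos α, ρ * sin α, 1]

/-- `x cos θ + y sin θ + z` has at most two zeros on the circle unless it vanishes. -/
theorem eq_zero_of_trig_eq_zero {x y z a b c : ℝ} (hab : sin ((a - b) / 2) ≠ 0)
    (hac : sin ((a - c) / 2) ≠ 0) (hbc : sin ((b - c) / 2) ≠ 0)
    (ha : x * cos a + y * sin a + z = 0) (hb : x * cos b + y * sin b + z = 0)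
    (hc : x * cos c + y * sin c + z = 0) : x = 0 ∧ y = 0 ∧ z = 0 := by
  have h1 : y * cos ((a + b) / 2) = x * sin ((a + b) / 2) := by
    have h := cos_sub_cos a b
    have h' := sin_sub_sin a b
    apply mul_left_cancel₀ hab
    linear_combination (ha - hb) / 2 - x / 2 * h - y / 2 * h'
  have h2 : y * cos ((a + c) / 2) = x * sin ((a + c) / 2) := by
    have h := cos_sub_cos a c
    have h' := sin_sub_sin a c
    apply mul_left_cancel₀ hac
    linear_combination (ha - hc) / 2 - x / 2 * h - y / 2 * h'
  have h3 : sin ((b - c) / 2) = sin ((a + b) / 2) * cos ((a + c) / 2)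
      - cos ((a + b) / 2) * sin ((a + c) / 2) := by
    rw [← sin_sub]; congr 1; ring
  have hx : x = 0 := by
    apply (mul_eq_zero.1 _).resolve_right hbc
    rw [h3]
    linear_combination (-cos ((a + c) / 2)) * h1 + cos ((a + b) / 2) * h2
  have hy : y = 0 := by
    apply (mul_eq_zero.1 _).resolve_right hbc
    rw [h3]
    linear_combination (-sin ((a + c) / 2)) * h1 + sin ((a + b) / 2) * h2
  subst hx hy
  exact ⟨rfl, rfl, by linarith⟩

theorem linearIndependent_circlePt {ρ : ℝ} (hρ : ρ ≠ 0) {α : Fin 3 → ℝ}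
    (h : ∀ i j, i ≠ j → sin ((α i - α j) / 2) ≠ 0) :
    LinearIndependent ℝ fun i => circlePt ρ (α i) := by
  have h1 : IsUnit (Matrix.of fun i => circlePt ρ (α i)) := by
    rw [← Matrix.mulVec_injective_iff_isUnit]
    refine (injective_iff_map_eq_zero (Matrix.mulVecLin _)).2 fun v hv => ?_
    have hv' : ∀ i, (v 0 * ρ) * cos (α i) + (v 1 * ρ) * sin (α i) + v 2 = 0 := fun i => by
      have := congrFun hv i
      simp only [Matrix.mulVecLin_apply, Matrix.mulVec, dotProduct, Matrix.of_apply, circlePt,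
        Fin.sum_univ_three, Matrix.cons_val_zero, Matrix.cons_val_one, Matrix.cons_val,
        Pi.zero_apply] at this
      linear_combination this
    obtain ⟨hx, hy, hz⟩ := eq_zero_of_trig_eq_zero (h 0 1 (by decide)) (h 0 2 (by decide))
      (h 1 2 (by decide)) (hv' 0) (hv' 1) (hv' 2)
    ext i
    fin_cases i
    · exact (mul_eq_zero.1 hx).resolve_right hρ
    · exact (mul_eq_zero.1 hy).resolve_right hρ
    · exact hz
  exact Matrix.linearIndependent_rows_iff_isUnit.2 h1

theorem sin_int_mul_pi_div_ne_zero {n : ℕ} (hn : 0 < n) {d : ℤ} (hd : ¬ (n : ℤ) ∣ d) :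
    sin (d * π / n) ≠ 0 := by
  intro h
  obtain ⟨k, hk⟩ := sin_eq_zero_iff.1 h
  have hn' : (n : ℝ) ≠ 0 := by positivity
  apply hd
  refine ⟨k, ?_⟩
  have : (d : ℝ) = n * k := by
    field_simp at hk
    linarith
  exact_mod_cast this

theorem sin_natCast_sub_mul_pi_div_ne_zero {n k j : ℕ} (h1 : k ≠ j) (h2 : k < j + n)
    (h3 : j < k + n) : sin (((k : ℝ) - j) * π / n) ≠ 0 := by
  have := sin_int_mul_pi_div_ne_zero (n := n) (by omega) (d := (k : ℤ) - j) (by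
    rintro ⟨c, hc⟩
    have hc0 : c ≠ 0 := by rintro rfl; omega
    rcases lt_or_gt_of_ne hc0 with h | h <;> nlinarith)
  simpa using this

end Circle

/-! ### The odd polygon: states, and the functions given by vectors -/

section Polygon

open Real

variable {m : ℕ}

theorem cos_pi_div_pos {n : ℕ} (hn : 3 ≤ n) : 0 < cos (π / n) := by
  have hn' : (3 : ℝ) ≤ n := by exact_mod_cast hn
  apply cos_pos_of_mem_Ioo
  constructor
  · have : 0 < π / n := by positivity
    linarith [pi_pos]
  · rw [div_lt_div_iff_of_pos_left pi_pos (by linarith) (by norm_num)]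
    linarith

theorem gVec_eq (n k : ℕ) :
    gVec n k = (1 / (1 + 1 / cos (π / n))) • circlePt (-1) ((2 * k - 1) * π / n) := by
  simp [gVec, circlePt]

theorem polygonVertex_add {n : ℕ} (hn : 0 < n) (k : ℕ) :
    polygonVertex n (k + n) = polygonVertex n k := by
  have : (n : ℝ) ≠ 0 := by positivity
  have h : 2 * ((k + n : ℕ) : ℝ) * π / n = 2 * k * π / n + 2 * π := by
    push_cast; field_simp
  simp only [polygonVertex, h, cos_add_two_pi, sin_add_two_pi]

theorem gVec_add {n : ℕ} (hn : 0 < n) (k : ℕ) : gVec n (k + n) = gVec n k := by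
  have : (n : ℝ) ≠ 0 := by positivity
  have h : (2 * ((k + n : ℕ) : ℝ) - 1) * π / n = (2 * k - 1) * π / n + 2 * π := by
    push_cast; field_simp; ring
  simp only [gVec, h, cos_add_two_pi, sin_add_two_pi]

/-- Every residue class modulo `n` has a representative in `{1, …, n}`. -/
theorem exists_mem_Icc_apply_eq {α : Type*} {n : ℕ} (hn : 0 < n) {f : ℕ → α}
    (hf : ∀ k, f (k + n) = f k) (k : ℕ) : ∃ j ∈ Finset.Icc 1 n, f k = f j := by
  induction k using Nat.strong_induction_on with
  | _ k ih =>
    rcases Nat.lt_or_ge n k with h | h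
    · obtain ⟨j, hj, h1⟩ := ih (k - n) (by omega)
      refine ⟨j, hj, ?_⟩
      rw [← h1, ← hf (k - n), Nat.sub_add_cancel h.le]
    · rcases Nat.eq_zero_or_pos k with rfl | h0
      · exact ⟨n, Finset.mem_Icc.2 ⟨hn, le_rfl⟩, by rw [← hf 0, zero_add]⟩
      · exact ⟨k, Finset.mem_Icc.2 ⟨h0, h⟩, rfl⟩

theorem polygonVertex_mem {n : ℕ} (hn : 0 < n) (k : ℕ) : polygonVertex n k ∈ polygon n := by
  obtain ⟨j, hj, h⟩ := exists_mem_Icc_apply_eq hn (polygonVertex_add hn) k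
  rw [h]
  exact subset_convexHull ℝ _ ⟨j, by simpa using hj, rfl⟩

/-- A vertex as an element of the state space. -/
noncomputable def vertex (m k : ℕ) : polygon (2 * m + 1) :=
  ⟨polygonVertex (2 * m + 1) k, polygonVertex_mem (by omega) k⟩

/-- What holds at the vertices and is stable under convex combinations holds on the polygon. -/
theorem polygon_induction {n : ℕ} {P : (Fin 3 → ℝ) → Prop} (hP : Convex ℝ {s | P s})
    (h : ∀ k ∈ Finset.Icc 1 n, P (polygonVertex n k)) {s : Fin 3 → ℝ} (hs : s ∈ polygon n) :
    P s := by
  refine convexHull_min ?_ hP hs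
  rintro _ ⟨k, hk, rfl⟩
  exact h k (by simpa using hk)

theorem apply_two_of_mem_polygon {n : ℕ} {s : Fin 3 → ℝ} (hs : s ∈ polygon n) : s 2 = 1 := by
  refine polygon_induction (P := fun s => s 2 = 1) ?_ (fun k _ => rfl) hs
  intro x hx y hy a b _ _ hab
  simp only [Set.mem_ofPred_eq, Pi.add_apply, Pi.smul_apply, smul_eq_mul] at *
  rw [hx, hy]; linarith

/-- Three consecutive vertices are linearly independent. -/
theorem linearIndependent_polygonVertex (hm : 1 ≤ m) (j : ℕ) :
    LinearIndependent ℝ fun i : Fin 3 => polygonVertex (2 * m + 1) (j + i) := by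
  have hc := cos_pi_div_pos (n := 2 * m + 1) (by omega)
  refine linearIndependent_circlePt (by positivity) fun i k hik => ?_
  have := sin_natCast_sub_mul_pi_div_ne_zero (n := 2 * m + 1) (k := j + i) (j := j + k)
    (by omega) (by omega) (by omega)
  convert this using 2
  ring

/-- Any three distinct vectors `g k` are linearly independent. -/
theorem linearIndependent_gVec {T : Finset ℕ} (hT : T ⊆ Finset.Icc 1 (2 * m + 1))
    (h3 : T.card = 3) : LinearIndependent ℝ fun k : T => gVec (2 * m + 1) k := by
  have hm : 1 ≤ m := by
    have := Finset.card_le_card hT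
    rw [h3, Nat.card_Icc] at this
    omega
  have hc := cos_pi_div_pos (n := 2 * m + 1) (by omega)
  have hκ : 1 / (1 + 1 / cos (π / (2 * m + 1 : ℕ))) ≠ 0 := by positivity
  rw [← linearIndependent_equiv (T.equivFinOfCardEq h3).symm]
  set e := (T.equivFinOfCardEq h3).symm
  have h := linearIndependent_circlePt (ρ := -1) (by norm_num)
    (α := fun i => (2 * ((e i : ℕ) : ℝ) - 1) * π / (2 * m + 1 : ℕ)) fun i j hij => ?_
  · have h' := h.units_smul fun _ => Units.mk0 _ hκ
    convert h' using 1
    ext1 i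
    exact gVec_eq _ _
  · have h1 := Finset.mem_Icc.1 (hT (e i).2)
    have h2 := Finset.mem_Icc.1 (hT (e j).2)
    have h3 : (e i : ℕ) ≠ e j := fun h => hij (e.injective (Subtype.ext h))
    have := sin_natCast_sub_mul_pi_div_ne_zero (n := 2 * m + 1) (k := e i) (j := e j)
      h3 (by omega) (by omega)
    convert this using 2
    ring

/-- A vector is determined by its products with three consecutive vertices. -/
theorem eq_of_dotProduct_polygonVertex_eq (hm : 1 ≤ m) (j : ℕ) {v w : Fin 3 → ℝ}
    (h : ∀ i : Fin 3, v ⬝ᵥ polygonVertex (2 * m + 1) (j + i)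
      = w ⬝ᵥ polygonVertex (2 * m + 1) (j + i)) : v = w := by
  have h1 : IsUnit (Matrix.of fun i : Fin 3 => polygonVertex (2 * m + 1) (j + i)) :=
    Matrix.linearIndependent_rows_iff_isUnit.1 (linearIndependent_polygonVertex hm j)
  apply Matrix.mulVec_injective_iff_isUnit.2 h1
  ext i
  have := h i
  rw [dotProduct_comm, dotProduct_comm w] at this
  exact this

/-- `dotEffect` as a linear map. -/
noncomputable def dotLin (n : ℕ) : (Fin 3 → ℝ) →ₗ[ℝ] (polygon n → ℝ) where
  toFun := dotEffect n
  map_add' v w := by ext s; simp [dotEffect, add_dotProduct]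
  map_smul' a v := by ext s; simp [dotEffect, smul_dotProduct]

theorem dotEffect_smul (n : ℕ) (a : ℝ) (v : Fin 3 → ℝ) :
    dotEffect n (a • v) = a • dotEffect n v := (dotLin n).map_smul a v

theorem dotEffect_sum {ι : Type*} (n : ℕ) (s : Finset ι) (v : ι → Fin 3 → ℝ) :
    dotEffect n (∑ i ∈ s, v i) = ∑ i ∈ s, dotEffect n (v i) := map_sum (dotLin n) v s

theorem dotEffect_injective (hm : 1 ≤ m) : Function.Injective (dotEffect (2 * m + 1)) := by
  intro v w h
  exact eq_of_dotProduct_polygonVertex_eq hm 0 fun i => congrFun h (vertex m (0 + i))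

theorem dotEffect_unit (n : ℕ) : dotEffect n ![0, 0, 1] = 1 := by
  ext s
  simp [dotEffect, dotProduct, Fin.sum_univ_three, apply_two_of_mem_polygon s.2]

theorem isEffect_dotEffect {n : ℕ} {v : Fin 3 → ℝ}
    (h : ∀ s, 0 ≤ dotEffect n v s ∧ dotEffect n v s ≤ 1) :
    IsEffect (polygon n) (dotEffect n v) := by
  refine ⟨h, fun p s t r _ _ hr => ?_⟩
  simp [dotEffect, hr, dotProduct_add, dotProduct_smul]

theorem gVec_dotProduct_polygonVertex (n k j : ℕ) :
    gVec n k ⬝ᵥ polygonVertex n j = (1 / (1 + 1 / cos (π / n))) *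
      (1 - 1 / cos (π / n) * cos ((2 * (k - j : ℤ) - 1 : ℤ) * π / n)) := by
  have h : ((2 * (k - j : ℤ) - 1 : ℤ) : ℝ) * π / n = (2 * k - 1) * π / n - 2 * j * π / n := by
    push_cast; ring
  rw [h, cos_sub]
  simp [gVec, polygonVertex, dotProduct, Fin.sum_univ_three]
  ring

/-- Among the odd multiples of `π / n`, for odd `n`, the cosine is largest at `π / n`. -/
theorem cos_odd_mul_le {i : ℤ} (hi : Odd i) :
    cos (i * π / (2 * m + 1 : ℕ)) ≤ cos (π / (2 * m + 1 : ℕ)) := by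
  set N : ℤ := 2 * m + 1 with hN
  have hN0 : (0 : ℝ) < (2 * m + 1 : ℕ) := by positivity
  have hNR : ((N : ℤ) : ℝ) = ((2 * m + 1 : ℕ) : ℝ) := by simp [hN]
  have key : ∀ j : ℤ, 1 ≤ j → j ≤ N →
      cos (j * π / (2 * m + 1 : ℕ)) ≤ cos (π / (2 * m + 1 : ℕ)) := by
    intro j h1 h2
    have h1' : (1 : ℝ) ≤ j := by exact_mod_cast h1
    have h2' : (j : ℝ) ≤ (2 * m + 1 : ℕ) := by rw [← hNR]; exact_mod_cast h2
    apply cos_le_cos_of_nonneg_of_le_pi (by positivity)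
    · rw [div_le_iff₀ hN0]
      nlinarith [pi_pos]
    · gcongr
      nlinarith [pi_pos]
  have hlt := Int.emod_lt_of_pos i (show 0 < 2 * N by omega)
  have hge := Int.emod_nonneg i (show 2 * N ≠ 0 by omega)
  have hdiv := Int.emod_add_mul_ediv i (2 * N)
  set j := i % (2 * N)
  set q := i / (2 * N)
  have hj : Odd j := by
    obtain ⟨c, hc⟩ := hi
    exact ⟨c - N * q, by linarith⟩
  have hcos : cos (i * π / (2 * m + 1 : ℕ)) = cos (j * π / (2 * m + 1 : ℕ)) := by
    have : (i : ℝ) * π / (2 * m + 1 : ℕ) = j * π / (2 * m + 1 : ℕ) + q * (2 * π) := by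
      have h3 : (i : ℝ) = j + 2 * (2 * m + 1 : ℕ) * q := by rw [← hNR]; exact_mod_cast hdiv.symm
      rw [h3]
      field_simp
    rw [this, cos_add_int_mul_two_pi]
  obtain ⟨c, hc⟩ := hj
  rw [hcos]
  rcases le_or_gt j N with h | h
  · exact key j (by omega) h
  · have h4 := key (2 * N - j) (by omega) (by omega)
    have h5 : ((2 * N - j : ℤ) : ℝ) * π / (2 * m + 1 : ℕ) = 2 * π - j * π / (2 * m + 1 : ℕ) := by
      push_cast
      rw [hNR]
      push_cast
      field_simp
    rwa [h5, cos_two_pi_sub] at h4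

theorem gVec_dotProduct_nonneg (hm : 1 ≤ m) (k j : ℕ) :
    0 ≤ gVec (2 * m + 1) k ⬝ᵥ polygonVertex (2 * m + 1) j := by
  have hc := cos_pi_div_pos (n := 2 * m + 1) (by omega)
  rw [gVec_dotProduct_polygonVertex]
  refine mul_nonneg (by positivity) (sub_nonneg.2 ?_)
  rw [div_mul_eq_mul_div, one_mul, div_le_one hc]
  exact cos_odd_mul_le ⟨k - j - 1, by ring⟩

theorem gVec_dotProduct_self (hm : 1 ≤ m) (k : ℕ) :
    gVec (2 * m + 1) k ⬝ᵥ polygonVertex (2 * m + 1) k = 0 := by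
  have hc := cos_pi_div_pos (n := 2 * m + 1) (by omega)
  have h : ((2 * (k - k : ℤ) - 1 : ℤ) : ℝ) * π / (2 * m + 1 : ℕ) = -(π / (2 * m + 1 : ℕ)) := by
    push_cast; ring
  rw [gVec_dotProduct_polygonVertex, h, cos_neg]
  field_simp
  simp

theorem gVec_succ_dotProduct (hm : 1 ≤ m) (k : ℕ) :
    gVec (2 * m + 1) (k + 1) ⬝ᵥ polygonVertex (2 * m + 1) k = 0 := by
  have hc := cos_pi_div_pos (n := 2 * m + 1) (by omega)
  have h : ((2 * ((k + 1 : ℕ) - k : ℤ) - 1 : ℤ) : ℝ) * π / (2 * m + 1 : ℕ)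
      = π / (2 * m + 1 : ℕ) := by
    push_cast; ring
  rw [gVec_dotProduct_polygonVertex, h]
  field_simp
  simp

theorem dotEffect_gVec_nonneg (hm : 1 ≤ m) (k : ℕ) (s : polygon (2 * m + 1)) :
    0 ≤ dotEffect (2 * m + 1) (gVec (2 * m + 1) k) s := by
  refine polygon_induction (P := fun s => 0 ≤ gVec (2 * m + 1) k ⬝ᵥ s) ?_
    (fun j _ => gVec_dotProduct_nonneg hm k j) s.2
  intro x hx y hy a b ha hb _
  simp only [Set.mem_ofPred_eq, dotProduct_add, dotProduct_smul, smul_eq_mul] at *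
  positivity

theorem gVec_ne_zero (hm : 1 ≤ m) (k : ℕ) : gVec (2 * m + 1) k ≠ 0 := by
  have hc := cos_pi_div_pos (n := 2 * m + 1) (by omega)
  intro h
  have := congrFun h 2
  simp only [gVec, Pi.smul_apply, Matrix.cons_val, smul_eq_mul, mul_one, Pi.zero_apply] at this
  exact absurd this (by positivity)

/-- `g k` vanishes on the edge between the vertices `k - 1` and `k`, hence not at a third one. -/
theorem gVec_dotProduct_pos (hm : 1 ≤ m) (j : ℕ) :
    0 < gVec (2 * m + 1) (j + 1) ⬝ᵥ polygonVertex (2 * m + 1) (j + 2) ∧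
    0 < gVec (2 * m + 1) (j + 2) ⬝ᵥ polygonVertex (2 * m + 1) j := by
  have hne := gVec_ne_zero hm
  constructor
  · refine lt_of_le_of_ne (gVec_dotProduct_nonneg hm _ _) fun h => hne (j + 1) ?_
    refine eq_of_dotProduct_polygonVertex_eq hm j fun i => ?_
    fin_cases i
    · simpa using gVec_succ_dotProduct hm j
    · simpa using gVec_dotProduct_self hm (j + 1)
    · simpa using h.symm
  · refine lt_of_le_of_ne (gVec_dotProduct_nonneg hm _ _) fun h => hne (j + 2) ?_
    refine eq_of_dotProduct_polygonVertex_eq hm j fun i => ?_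
    fin_cases i
    · simpa using h.symm
    · simpa using gVec_succ_dotProduct hm (j + 1)
    · simpa using gVec_dotProduct_self hm (j + 2)

end Polygon

/-! ### Effects on the odd polygon -/

section PolygonEffects

variable {m : ℕ}

/-- A function on the polygon that preserves convex combinations and vanishes at three vertices
spanning the plane is zero: it vanishes on their triangle, and every state `s` lies on a line
through the centroid of the triangle of which a segment lies in the triangle. -/
theorem eq_zero_of_affine (hm : 1 ≤ m) {h : polygon (2 * m + 1) → ℝ}
    (haff : ∀ (p : ℝ) (s t r : polygon (2 * m + 1)), 0 ≤ p → p ≤ 1 →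
      (r : Fin 3 → ℝ) = p • (s : Fin 3 → ℝ) + (1 - p) • (t : Fin 3 → ℝ) →
      h r = p * h s + (1 - p) * h t)
    (h0 : ∀ i : Fin 3, h (vertex m (0 + i)) = 0) : h = 0 := by
  set P : Fin 3 → polygon (2 * m + 1) := fun i => vertex m (0 + i)
  have hconv : Convex ℝ (polygon (2 * m + 1)) := convex_convexHull ℝ _
  have tri : ∀ (a b c : ℝ) (r : polygon (2 * m + 1)), 0 ≤ a → 0 ≤ b → 0 ≤ c → a + b + c = 1 →
      (r : Fin 3 → ℝ) = a • (P 0 : Fin 3 → ℝ) + b • (P 1 : Fin 3 → ℝ) + c • (P 2 : Fin 3 → ℝ) →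
      h r = 0 := by
    intro a b c r ha hb hc habc hr
    rcases eq_or_ne (a + b) 0 with hab | hab
    · have ha0 : a = 0 := by linarith
      have hb0 : b = 0 := by linarith
      rw [haff c (P 2) (P 0) r hc (by linarith) (by
        rw [hr, ha0, hb0, show c = 1 by linarith]; simp), h0, h0]
      simp
    · have hpos : 0 < a + b := lt_of_le_of_ne (by positivity) hab.symm
      have hab1 : a / (a + b) + b / (a + b) = 1 := by field_simp
      let t : polygon (2 * m + 1) := ⟨(a / (a + b)) • (P 0 : Fin 3 → ℝ) +
        (b / (a + b)) • (P 1 : Fin 3 → ℝ), hconv (P 0).2 (P 1).2 (by positivity) (by positivity)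
          hab1⟩
      have ht : h t = 0 := by
        rw [haff (a / (a + b)) (P 0) (P 1) t (by positivity)
          (by linarith [show 0 ≤ b / (a + b) by positivity])
          (by rw [show 1 - a / (a + b) = b / (a + b) by linarith]), h0, h0]
        simp
      rw [haff c (P 2) t r hc (by linarith) (by
        rw [hr, show 1 - c = a + b by linarith]
        simp only [t, smul_add, smul_smul, mul_div_cancel₀ _ hab]
        abel), ht, h0]
      simp
  ext s
  let b := basisOfLinearIndependentOfCardEqFinrank (linearIndependent_polygonVertex hm 0)
    (by simp)
  set l := fun i => b.repr s i
  have hs : (s : Fin 3 → ℝ) = l 0 • (P 0 : Fin 3 → ℝ) + l 1 • (P 1 : Fin 3 → ℝ)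
      + l 2 • (P 2 : Fin 3 → ℝ) := by
    have := b.sum_repr (s : Fin 3 → ℝ)
    rw [Fin.sum_univ_three] at this
    simpa [b, P, vertex, l] using this.symm
  have hsum : l 0 + l 1 + l 2 = 1 := by
    have := congrFun hs 2
    simpa [apply_two_of_mem_polygon (P _).2, apply_two_of_mem_polygon s.2] using this.symm
  -- so small that all coordinates of `ε • s + (1 - ε) • c`, `c` the centroid, are nonnegative
  set ε : ℝ := 1 / (4 * (1 + |l 0| + |l 1| + |l 2|)) with hε
  have hM : 0 < 1 + |l 0| + |l 1| + |l 2| := by positivity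
  have hε0 : 0 < ε := by positivity
  have hεM : ε * (1 + |l 0| + |l 1| + |l 2|) = 1 / 4 := by rw [hε]; field_simp
  have p0 := mul_nonneg hε0.le (abs_nonneg (l 0))
  have p1 := mul_nonneg hε0.le (abs_nonneg (l 1))
  have p2 := mul_nonneg hε0.le (abs_nonneg (l 2))
  have q0 := mul_le_mul_of_nonneg_left (neg_abs_le (l 0)) hε0.le
  have q1 := mul_le_mul_of_nonneg_left (neg_abs_le (l 1)) hε0.le
  have q2 := mul_le_mul_of_nonneg_left (neg_abs_le (l 2)) hε0.le
  have hε1 : ε ≤ 1 / 4 := by linarith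
  let c : polygon (2 * m + 1) := ⟨(2 / 3 : ℝ) • ((1 / 2 : ℝ) • (P 0 : Fin 3 → ℝ) +
    (1 / 2 : ℝ) • (P 1 : Fin 3 → ℝ)) + (1 / 3 : ℝ) • (P 2 : Fin 3 → ℝ),
    hconv (hconv (P 0).2 (P 1).2 (by norm_num) (by norm_num) (by norm_num)) (P 2).2
      (by norm_num) (by norm_num) (by norm_num)⟩
  have hc : h c = 0 := tri (1 / 3) (1 / 3) (1 / 3) c (by norm_num) (by norm_num) (by norm_num)
    (by norm_num) (by simp only [c]; module)
  let r : polygon (2 * m + 1) := ⟨ε • (s : Fin 3 → ℝ) + (1 - ε) • (c : Fin 3 → ℝ),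
    hconv s.2 c.2 hε0.le (by linarith) (by ring)⟩
  have hr : h r = 0 := tri (ε * l 0 + (1 - ε) / 3) (ε * l 1 + (1 - ε) / 3)
    (ε * l 2 + (1 - ε) / 3) r (by linarith) (by linarith) (by linarith)
    (by linear_combination ε * hsum) (by simp only [r, c]; rw [hs]; module)
  have := haff ε s c r hε0.le (by linarith) rfl
  rw [hr, hc, mul_zero, add_zero] at this
  exact (mul_eq_zero.1 this.symm).resolve_left hε0.ne'

/-- Effects on the polygon are given by vectors. -/
theorem IsEffect.exists_eq_dotEffect (hm : 1 ≤ m) {e : polygon (2 * m + 1) → ℝ}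
    (he : IsEffect (polygon (2 * m + 1)) e) : ∃ v, e = dotEffect (2 * m + 1) v := by
  let b := basisOfLinearIndependentOfCardEqFinrank (linearIndependent_polygonVertex hm 0)
    (by simp)
  let L := b.constr ℝ fun i : Fin 3 => e (vertex m (0 + i))
  let v : Fin 3 → ℝ := fun j => L (Pi.single j 1)
  have hv : ∀ s : Fin 3 → ℝ, v ⬝ᵥ s = L s := fun s => by
    rw [L.pi_apply_eq_sum_univ s]
    simp only [dotProduct, v, smul_eq_mul]
    refine Finset.sum_congr rfl fun j _ => ?_
    rw [mul_comm]
    congr 2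
    ext i
    simp [Pi.single_apply, eq_comm]
  refine ⟨v, ?_⟩
  rw [← sub_eq_zero]
  refine eq_zero_of_affine hm (fun p s t r hp hp1 hr => ?_) fun i => ?_
  · simp only [Pi.sub_apply, he.2 p s t r hp hp1 hr, dotEffect, hr, dotProduct_add,
      dotProduct_smul, smul_eq_mul]
    ring
  · have h1 : L (b i) = e (vertex m (0 + i)) := b.constr_basis ℝ _ i
    have h2 : b i = (vertex m (0 + i) : Fin 3 → ℝ) := by simp [b, vertex]
    simp only [Pi.sub_apply, dotEffect, hv, ← h2, h1, sub_self]

/-- `g k` spans an extreme ray: an effect below a multiple of it vanishes with it at two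
vertices. -/
theorem isIndecomposableEffect_smul_gVec (hm : 1 ≤ m) {k : ℕ} (hk : 1 ≤ k) {c : ℝ} (hc : 0 < c)
    (he : IsEffect (polygon (2 * m + 1)) (c • dotEffect (2 * m + 1) (gVec (2 * m + 1) k))) :
    IsIndecomposableEffect (polygon (2 * m + 1))
      (c • dotEffect (2 * m + 1) (gVec (2 * m + 1) k)) := by
  obtain ⟨j, rfl⟩ : ∃ j, k = j + 1 := ⟨k - 1, by omega⟩
  have hpos := (gVec_dotProduct_pos hm j).1
  have key : ∀ f, IsEffect (polygon (2 * m + 1)) f →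
      f ≤ c • dotEffect (2 * m + 1) (gVec (2 * m + 1) (j + 1)) →
      ∃ a : ℝ, f = a • (c • dotEffect (2 * m + 1) (gVec (2 * m + 1) (j + 1))) := by
    intro f hf hle
    obtain ⟨v, rfl⟩ := hf.exists_eq_dotEffect hm
    have hz : ∀ i, gVec (2 * m + 1) (j + 1) ⬝ᵥ polygonVertex (2 * m + 1) i = 0 →
        v ⬝ᵥ polygonVertex (2 * m + 1) i = 0 := by
      intro i hi
      refine le_antisymm ?_ (hf.1 (vertex m i)).1
      have := hle (vertex m i)
      simpa [dotEffect, vertex, hi] using this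
    set q := gVec (2 * m + 1) (j + 1) ⬝ᵥ polygonVertex (2 * m + 1) (j + 2)
    refine ⟨v ⬝ᵥ polygonVertex (2 * m + 1) (j + 2) / (c * q), ?_⟩
    rw [← dotEffect_smul, ← dotEffect_smul]
    congr 1
    -- both sides vanish at the vertices `j` and `j + 1` and agree at `j + 2`
    refine eq_of_dotProduct_polygonVertex_eq hm j fun i => ?_
    rw [smul_smul, smul_dotProduct, smul_eq_mul]
    fin_cases i
    · have h1 := gVec_succ_dotProduct hm j
      simpa [h1] using hz j h1
    · have h1 := gVec_dotProduct_self hm (j + 1)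
      simpa [h1] using hz (j + 1) h1
    · change v ⬝ᵥ polygonVertex (2 * m + 1) (j + 2) = _ * q
      field_simp
  refine ⟨he, fun h => ?_, fun e₁ e₂ h₁ h₂ h => ?_⟩
  · have h1 := congrFun h (vertex m (j + 2))
    have h2 : c * (gVec (2 * m + 1) (j + 1) ⬝ᵥ polygonVertex (2 * m + 1) (j + 2)) = 0 := h1
    exact absurd h2 (by positivity)
  · refine ⟨key e₁ h₁ fun s => ?_, key e₂ h₂ fun s => ?_⟩
    · rw [h]
      have := (h₂.1 s).1
      simp only [Pi.add_apply]
      linarith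
    · rw [h]
      have := (h₁.1 s).1
      simp only [Pi.add_apply]
      linarith

end PolygonEffects

/-! ### Central triangles -/

theorem mem_convexHull_image_finset {ι E : Type*} [AddCommGroup E] [Module ℝ E] {f : ι → E}
    {T : Finset ι} {x : E} : x ∈ convexHull ℝ (f '' (T : Set ι)) ↔
      ∃ w : ι → ℝ, (∀ k ∈ T, 0 ≤ w k) ∧ ∑ k ∈ T, w k = 1 ∧ ∑ k ∈ T, w k • f k = x := by
  classical
  constructor
  · intro hx
    refine convexHull_min (t := {x | ∃ w : ι → ℝ, (∀ k ∈ T, 0 ≤ w k) ∧ ∑ k ∈ T, w k = 1 ∧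
      ∑ k ∈ T, w k • f k = x}) ?_ ?_ hx
    · rintro _ ⟨k, hk, rfl⟩
      have hk' : k ∈ T := hk
      refine ⟨fun j => if j = k then 1 else 0, fun j _ => ?_, ?_, ?_⟩
      · dsimp only
        split_ifs <;> norm_num
      · simp [hk']
      · simp [ite_smul, hk']
    · rintro _ ⟨w, hw0, hw1, rfl⟩ _ ⟨w', hw0', hw1', rfl⟩ a b ha hb hab
      refine ⟨fun k => a * w k + b * w' k, fun k hk => ?_, ?_, ?_⟩
      · have := hw0 k hk
        have := hw0' k hk
        positivity
      · rw [Finset.sum_add_distrib, ← Finset.mul_sum, ← Finset.mul_sum, hw1, hw1']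
        linarith
      · simp only [add_smul, mul_smul, Finset.sum_add_distrib, ← Finset.smul_sum]
  · rintro ⟨w, hw0, hw1, rfl⟩
    exact (convex_convexHull ℝ _).sum_mem hw0 hw1 fun k hk =>
      subset_convexHull ℝ _ ⟨k, hk, rfl⟩

section Triangles

open Real

variable {m : ℕ}

/-- The angle of `g k` (shifted by `π`). -/
noncomputable def gAngle (m k : ℕ) : ℝ := (2 * k - 1) * π / (2 * m + 1 : ℕ)

/-- The weights `w` on `T` have total mass `1` and express the center of the polygon of the `g k`
as their barycenter. They are not required to be nonnegative. -/
def IsBalanced (m : ℕ) (T : Finset ℕ) (w : ℕ → ℝ) : Prop :=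
  ∑ k ∈ T, w k = 1 ∧ ∑ k ∈ T, w k * cos (gAngle m k) = 0 ∧ ∑ k ∈ T, w k * sin (gAngle m k) = 0

theorem sum_smul_gVec (T : Finset ℕ) (w : ℕ → ℝ) :
    ∑ k ∈ T, w k • gVec (2 * m + 1) k = (1 / (1 + 1 / cos (π / (2 * m + 1 : ℕ)))) •
      ![-∑ k ∈ T, w k * cos (gAngle m k), -∑ k ∈ T, w k * sin (gAngle m k), ∑ k ∈ T, w k] := by
  ext i
  fin_cases i <;>
    simp only [gVec, Finset.sum_apply, Pi.smul_apply, smul_eq_mul, Finset.mul_sum,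
      ← Finset.sum_neg_distrib, gAngle, Fin.zero_eta, Fin.mk_one, Fin.reduceFinMk,
      Matrix.cons_val_zero, Matrix.cons_val_one, Matrix.cons_val] <;>
    exact Finset.sum_congr rfl fun k _ => by ring

theorem gFactor_pos (hm : 1 ≤ m) : 0 < 1 / (1 + 1 / cos (π / (2 * m + 1 : ℕ))) := by
  have hc := cos_pi_div_pos (n := 2 * m + 1) (by omega)
  positivity

theorem isBalanced_iff (hm : 1 ≤ m) {T : Finset ℕ} {w : ℕ → ℝ} :
    IsBalanced m T w ↔ ∑ k ∈ T, w k • gVec (2 * m + 1) k = gCenter (2 * m + 1) := by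
  rw [sum_smul_gVec, gCenter]
  constructor
  · rintro ⟨h1, h2, h3⟩
    simp [h1, h2, h3]
  · intro h
    have h' := smul_right_injective _ (gFactor_pos hm).ne' h
    exact ⟨congrFun h' 2, neg_eq_zero.1 (congrFun h' 0), neg_eq_zero.1 (congrFun h' 1)⟩

theorem mem_centralTriangles_iff_isBalanced (hm : 1 ≤ m) {T : Finset ℕ} :
    T ∈ centralTriangles (2 * m + 1) ↔ T ⊆ Finset.Icc 1 (2 * m + 1) ∧ T.card = 3 ∧
      ∃ w : ℕ → ℝ, (∀ k ∈ T, 0 ≤ w k) ∧ IsBalanced m T w := by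
  simp only [centralTriangles, Set.mem_ofPred_eq, mem_convexHull_image_finset, isBalanced_iff hm]
  refine and_congr_right fun _ => and_congr_right fun _ => exists_congr fun w =>
    and_congr_right fun _ => ⟨fun h => h.2, fun h => ⟨?_, h⟩⟩
  exact ((isBalanced_iff hm).2 h).1

theorem gAngle_sub (m j k : ℕ) :
    gAngle m j - gAngle m k = ((2 * (j - k : ℤ) : ℤ) : ℝ) * π / (2 * m + 1 : ℕ) := by
  simp only [gAngle]
  push_cast
  ring

theorem sin_gAngle_sub_ne_zero {j k : ℕ} (hj : j ∈ Finset.Icc 1 (2 * m + 1))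
    (hk : k ∈ Finset.Icc 1 (2 * m + 1)) (hjk : j ≠ k) : sin (gAngle m j - gAngle m k) ≠ 0 := by
  rw [Finset.mem_Icc] at hj hk
  rw [gAngle_sub]
  refine sin_int_mul_pi_div_ne_zero (by omega) ?_
  rintro ⟨q, hq⟩
  push_cast at hq
  have h1 : q < 2 := by by_contra! h; nlinarith
  have h2 : -2 < q := by by_contra! h; nlinarith
  interval_cases q <;> omega

/-- A relation between three vectors of the plane, multiplied by the third of them in the cross
product. -/
theorem mul_sin_sub_add_eq_zero {a b c x y z : ℝ}
    (h1 : a * cos x + b * cos y + c * cos z = 0) (h2 : a * sin x + b * sin y + c * sin z = 0) :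
    a * sin (x - z) + b * sin (y - z) = 0 := by
  rw [sin_sub, sin_sub]
  linear_combination cos z * h2 - sin z * h1

/-- The center does not lie on a segment between two of the `g k`, since `n` is odd. -/
theorem IsBalanced.three_le_card {T : Finset ℕ} (hT : T ⊆ Finset.Icc 1 (2 * m + 1)) {w : ℕ → ℝ}
    (h : IsBalanced m T w) : 3 ≤ T.card := by
  obtain ⟨h1, h2, h3⟩ := h
  by_contra! hlt
  have hcases : T.card = 0 ∨ T.card = 1 ∨ T.card = 2 := by omega
  rcases hcases with h0 | h0 | h0
  · rw [Finset.card_eq_zero] at h0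
    subst h0
    simp at h1
  · obtain ⟨j, rfl⟩ := Finset.card_eq_one.1 h0
    simp only [Finset.sum_singleton] at h1 h2 h3
    rw [h1, one_mul] at h2 h3
    have := sin_sq_add_cos_sq (gAngle m j)
    rw [h2, h3] at this
    norm_num at this
  · obtain ⟨j, k, hjk, rfl⟩ := Finset.card_eq_two.1 h0
    have hs := sin_gAngle_sub_ne_zero (hT (by simp : j ∈ _)) (hT (by simp : k ∈ _)) hjk
    rw [Finset.sum_pair hjk] at h1 h2 h3
    have hj : w j * sin (gAngle m j - gAngle m k) + w k * sin (gAngle m k - gAngle m k) = 0 :=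
      mul_sin_sub_add_eq_zero (c := 0) (by linarith) (by linarith)
    have hk : w j * sin (gAngle m j - gAngle m j) + w k * sin (gAngle m k - gAngle m j) = 0 :=
      mul_sin_sub_add_eq_zero (c := 0) (by linarith) (by linarith)
    rw [sub_self, sin_zero, mul_zero, add_zero] at hj
    rw [sub_self, sin_zero, mul_zero, zero_add, ← neg_sub, sin_neg] at hk
    have hj' := (mul_eq_zero.1 hj).resolve_right hs
    have hk' := (mul_eq_zero.1 hk).resolve_right (neg_ne_zero.2 hs)
    linarith

/-- A zero weight would leave a balanced family of two vertices. -/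
theorem IsBalanced.pos {T : Finset ℕ} (hT : T ⊆ Finset.Icc 1 (2 * m + 1)) (h3 : T.card = 3)
    {w : ℕ → ℝ} (hw : ∀ k ∈ T, 0 ≤ w k) (h : IsBalanced m T w) : ∀ k ∈ T, 0 < w k := by
  intro k hk
  refine lt_of_le_of_ne (hw k hk) fun h0 => ?_
  have h' : IsBalanced m (T.erase k) w := by
    refine ⟨?_, ?_, ?_⟩
    · rw [Finset.sum_erase T h0.symm, h.1]
    · rw [Finset.sum_erase T (by rw [← h0, zero_mul]), h.2.1]
    · rw [Finset.sum_erase T (by rw [← h0, zero_mul]), h.2.2]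
  have := h'.three_le_card ((Finset.erase_subset _ _).trans hT)
  rw [Finset.card_erase_of_mem hk] at this
  omega

theorem sin_gAngle_sub_pos {j k : ℕ} (h : k < j) (h' : j ≤ k + m) :
    0 < sin (gAngle m j - gAngle m k) := by
  have hk : (k : ℝ) < j := by exact_mod_cast h
  have hj : (j : ℝ) ≤ k + m := by exact_mod_cast h'
  rw [gAngle_sub]
  push_cast
  have h0 : (0 : ℝ) < 2 * m + 1 := by positivity
  apply sin_pos_of_pos_of_lt_pi
  · have : (0 : ℝ) < j - k := by linarith
    positivity
  · rw [div_lt_iff₀ h0]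
    nlinarith [pi_pos]

theorem sin_gAngle_sub_neg {j k : ℕ} (h : k + m < j) (h' : j ≤ k + 2 * m) :
    sin (gAngle m j - gAngle m k) < 0 := by
  have hk : (k : ℝ) + m + 1 ≤ j := by exact_mod_cast h
  have hj : (j : ℝ) ≤ k + 2 * m := by exact_mod_cast h'
  rw [gAngle_sub]
  push_cast
  have h0 : (0 : ℝ) < 2 * m + 1 := by positivity
  rw [← sin_sub_two_pi]
  apply sin_neg_of_neg_of_neg_pi_lt
  · rw [sub_neg, div_lt_iff₀ h0]
    nlinarith [pi_pos]
  · rw [lt_sub_iff_add_lt, lt_div_iff₀ h0]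
    nlinarith [pi_pos]

/-- A triangle contains the center exactly when each of its three arcs has at most `m` steps. -/
theorem mem_centralTriangles_iff (hm : 1 ≤ m) {T : Finset ℕ} :
    T ∈ centralTriangles (2 * m + 1) ↔ ∃ a b c, 1 ≤ a ∧ a < b ∧ b < c ∧ c ≤ 2 * m + 1 ∧
      b ≤ a + m ∧ c ≤ b + m ∧ a + m < c ∧ T = {a, b, c} := by
  rw [mem_centralTriangles_iff_isBalanced hm]
  constructor
  · rintro ⟨hT, h3, w, hw0, hw⟩
    have hpos := hw.pos hT h3 hw0
    let f := T.orderEmbOfFin h3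
    have hab : f 0 < f 1 := f.strictMono (by decide)
    have hbc : f 1 < f 2 := f.strictMono (by decide)
    have hTf : T = {f 0, f 1, f 2} := by
      ext x
      have := congrArg (x ∈ ·) (T.range_orderEmbOfFin h3)
      simp only [Set.mem_range, Finset.mem_coe, eq_iff_iff] at this
      rw [← this, Fin.exists_fin_succ, Fin.exists_fin_two]
      simp [f, eq_comm]
    generalize f 0 = a at *
    generalize f 1 = b at *
    generalize f 2 = c at *
    subst hTf
    have ha := Finset.mem_Icc.1 (hT (by simp : a ∈ _))
    have hc := Finset.mem_Icc.1 (hT (by simp : c ∈ _))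
    have wa := hpos a (by simp)
    have wb := hpos b (by simp)
    have wc := hpos c (by simp)
    have hsum : ∀ u : ℕ → ℝ, ∑ k ∈ ({a, b, c} : Finset ℕ), u k = u a + u b + u c := fun u => by
      rw [Finset.sum_insert (by simp; omega), Finset.sum_pair (by omega), add_assoc]
    obtain ⟨-, hcos, hsin⟩ := hw
    rw [hsum] at hcos hsin
    -- the relations between the weights and the sines of the arcs
    have r1 : w a * sin (gAngle m b - gAngle m a) = w c * sin (gAngle m c - gAngle m b) := by
      have := mul_sin_sub_add_eq_zero (a := w a) (b := w c) (c := w b) (x := gAngle m a)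
        (y := gAngle m c) (z := gAngle m b) (by linarith) (by linarith)
      rw [← neg_sub (gAngle m b), sin_neg] at this
      linarith
    have r2 : w b * sin (gAngle m b - gAngle m a) = -(w c * sin (gAngle m c - gAngle m a)) := by
      have := mul_sin_sub_add_eq_zero (a := w b) (b := w c) (c := w a) (x := gAngle m b)
        (y := gAngle m c) (z := gAngle m a) (by linarith) (by linarith)
      linarith
    have hb : b ≤ a + m := by
      by_contra! h
      have h1 := sin_gAngle_sub_neg h (by omega)
      have h2 := sin_gAngle_sub_pos (m := m) hbc (by omega)
      nlinarith [mul_neg_of_pos_of_neg wa h1, mul_pos wc h2]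
    have h1 := mul_pos wa (sin_gAngle_sub_pos hab hb)
    have h2 := mul_pos wb (sin_gAngle_sub_pos hab hb)
    refine ⟨a, b, c, ha.1, hab, hbc, hc.2, hb, ?_, ?_, rfl⟩
    · by_contra! h
      linarith [mul_neg_of_pos_of_neg wc (sin_gAngle_sub_neg h (by omega))]
    · by_contra! h
      linarith [mul_pos wc (sin_gAngle_sub_pos (m := m) (hab.trans hbc) h)]
  · rintro ⟨a, b, c, ha, hab, hbc, hc, hba, hcb, hca, rfl⟩
    have hsum : ∀ u : ℕ → ℝ, ∑ k ∈ ({a, b, c} : Finset ℕ), u k = u a + u b + u c := fun u => by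
      rw [Finset.sum_insert (by simp; omega), Finset.sum_pair (by omega), add_assoc]
    set A := sin (gAngle m c - gAngle m b) with hA
    set B := -sin (gAngle m c - gAngle m a) with hB
    set C := sin (gAngle m b - gAngle m a) with hC
    have hA0 : 0 < A := sin_gAngle_sub_pos hbc hcb
    have hB0 : 0 < B := neg_pos.2 (sin_gAngle_sub_neg hca (by omega))
    have hC0 : 0 < C := sin_gAngle_sub_pos hab hba
    have hs : A + B + C ≠ 0 := by positivity
    refine ⟨?_, ?_, fun k => if k = a then A / (A + B + C) else if k = b then B / (A + B + C)
      else C / (A + B + C), fun k _ => ?_, ?_⟩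
    · intro k hk
      simp only [Finset.mem_insert, Finset.mem_singleton] at hk
      rw [Finset.mem_Icc]
      omega
    · rw [Finset.card_eq_three]
      exact ⟨a, b, c, by omega, by omega, by omega, rfl⟩
    · dsimp only
      split_ifs <;> positivity
    · simp only [IsBalanced, hsum, if_true, if_neg (show b ≠ a by omega),
        if_neg (show c ≠ a by omega), if_neg (show c ≠ b by omega)]
      refine ⟨by field_simp, ?_, ?_⟩
      · have : A * cos (gAngle m a) + B * cos (gAngle m b) + C * cos (gAngle m c) = 0 := by
          rw [hA, hB, hC, sin_sub, sin_sub, sin_sub]; ring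
        field_simp
        linarith
      · have : A * sin (gAngle m a) + B * sin (gAngle m b) + C * sin (gAngle m c) = 0 := by
          rw [hA, hB, hC, sin_sub, sin_sub, sin_sub]; ring
        field_simp
        linarith

/-- With `t` the number of steps of the arc from `c` through `n` to `a`, there are `t` choices
of `a` and `t` choices of `b`, so the central triangles are counted by a sum of squares. -/
theorem encard_centralTriangles (hm : 1 ≤ m) :
    6 * (centralTriangles (2 * m + 1)).encard = ((m * (m + 1) * (2 * m + 1) : ℕ) : ℕ∞) := by
  let C : Finset (Σ _ : ℕ, ℕ × ℕ) :=
    (Finset.Icc 1 m).sigma fun t => Finset.range t ×ˢ Finset.range t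
  let φ : (Σ _ : ℕ, ℕ × ℕ) → Finset ℕ := fun x =>
    {1 + x.2.1, x.2.1 + x.2.2 + 2 + m - x.1, x.2.1 + 2 + 2 * m - x.1}
  have hC : ∀ x, x ∈ C ↔ (1 ≤ x.1 ∧ x.1 ≤ m) ∧ x.2.1 < x.1 ∧ x.2.2 < x.1 := fun x => by
    simp [C]
  have himg : centralTriangles (2 * m + 1) = φ '' (C : Set (Σ _ : ℕ, ℕ × ℕ)) := by
    ext T
    rw [mem_centralTriangles_iff hm]
    constructor
    · rintro ⟨a, b, c, ha, hab, hbc, hc, hba, hcb, hca, rfl⟩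
      refine ⟨⟨2 * m + 1 + a - c, a - 1, b + m - c⟩, ?_, ?_⟩
      · rw [Finset.mem_coe, hC]
        dsimp only
        omega
      · dsimp only [φ]
        congr 1
        · omega
        · congr 1
          · omega
          · congr 1
            omega
    · rintro ⟨⟨t, i, j⟩, hx, rfl⟩
      rw [Finset.mem_coe, hC] at hx
      dsimp only at hx
      refine ⟨1 + i, i + j + 2 + m - t, i + 2 + 2 * m - t, ?_, ?_, ?_, ?_, ?_, ?_, ?_, rfl⟩ <;>
        omega
  have hinj : Set.InjOn φ (C : Set (Σ _ : ℕ, ℕ × ℕ)) := by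
    rintro ⟨t, i, j⟩ hx ⟨t', i', j'⟩ hx' h
    rw [Finset.mem_coe, hC] at hx hx'
    dsimp only at hx hx'
    simp only [φ, Finset.ext_iff, Finset.mem_insert, Finset.mem_singleton] at h
    have h1 := (h (1 + i)).1 (by simp)
    have h2 := (h (i + j + 2 + m - t)).1 (by simp)
    have h3 := (h (i + 2 + 2 * m - t)).1 (by simp)
    have h1' := (h (1 + i')).2 (by simp)
    have h3' := (h (i' + 2 + 2 * m - t')).2 (by simp)
    obtain rfl : i = i' := by omega
    obtain rfl : t = t' := by omega
    obtain rfl : j = j' := by omega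
    rfl
  have hcard : 6 * C.card = m * (m + 1) * (2 * m + 1) := by
    have h1 : C.card = ∑ t ∈ Finset.Icc 1 m, t * t := by simp [C, Finset.card_sigma]
    have h2 : ∀ m : ℕ, 6 * ∑ t ∈ Finset.Icc 1 m, t * t = m * (m + 1) * (2 * m + 1) := by
      intro m
      induction m with
      | zero => simp
      | succ m ih =>
        rw [Finset.sum_Icc_succ_top (by omega), mul_add, ih]
        ring
    rw [h1, h2]
  rw [himg, hinj.encard_image, Set.encard_coe_eq_coe_finsetCard, ← hcard]
  push_cast
  rfl

end Triangles

/-! ### Decomposition over central triangles -/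

section Decomposition

open Real

variable {m : ℕ}

theorem isBalanced_of_sum_smul_gVec (hm : 1 ≤ m) {T : Finset ℕ} {w : ℕ → ℝ} {r : ℝ} (hr : r ≠ 0)
    (h : ∑ k ∈ T, w k • gVec (2 * m + 1) k = r • ![0, 0, 1]) :
    IsBalanced m T fun k => 1 / (1 + 1 / cos (π / (2 * m + 1 : ℕ))) / r * w k := by
  rw [isBalanced_iff hm]
  simp only [mul_smul, ← Finset.smul_sum, h, gCenter]
  rw [smul_smul, div_mul_cancel₀ _ hr]

theorem eq_of_cos_eq_of_sin_eq {j k : ℕ} (hj : j ∈ Finset.Icc 1 (2 * m + 1))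
    (hk : k ∈ Finset.Icc 1 (2 * m + 1)) (hc : cos (gAngle m j) = cos (gAngle m k))
    (hs : sin (gAngle m j) = sin (gAngle m k)) : j = k := by
  by_contra h
  apply sin_gAngle_sub_ne_zero hj hk h
  rw [sin_sub, hc, hs]
  ring

/-- By Carathéodory's theorem in the plane, the center is a convex combination of at most three of
the points of a family that has it in its convex hull, and two do not suffice. -/
theorem IsBalanced.exists_central_subset (hm : 1 ≤ m) {I : Finset ℕ}
    (hI : I ⊆ Finset.Icc 1 (2 * m + 1)) {w : ℕ → ℝ} (hw : ∀ k ∈ I, 0 ≤ w k)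
    (h : IsBalanced m I w) : ∃ T ⊆ I, T ∈ centralTriangles (2 * m + 1) := by
  classical
  let z : ℕ → ℝ × ℝ := fun k => (cos (gAngle m k), sin (gAngle m k))
  have hsum : ∀ (T : Finset ℕ) (w : ℕ → ℝ), ∑ k ∈ T, w k • z k =
      (∑ k ∈ T, w k * cos (gAngle m k), ∑ k ∈ T, w k * sin (gAngle m k)) := fun T w => by
    simp [z, Prod.ext_iff, Prod.fst_sum, Prod.snd_sum]
  have hz : Set.InjOn z (I : Set ℕ) := fun j hj k hk hjk =>
    eq_of_cos_eq_of_sin_eq (hI hj) (hI hk) (congrArg Prod.fst hjk) (congrArg Prod.snd hjk)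
  have h0 : (0 : ℝ × ℝ) ∈ convexHull ℝ (z '' (I : Set ℕ)) :=
    mem_convexHull_image_finset.2 ⟨w, hw, h.1, by rw [hsum, h.2.1, h.2.2]; rfl⟩
  rw [convexHull_eq_union] at h0
  simp only [Set.mem_iUnion] at h0
  obtain ⟨t, ht, hai, h0⟩ := h0
  obtain ⟨T, hTI, rfl⟩ := Finset.subset_set_image_iff.1 ht
  rw [Finset.coe_image] at h0
  obtain ⟨w', hw0, hw1, hw'⟩ := mem_convexHull_image_finset.1 h0
  rw [hsum] at hw'
  have hbal : IsBalanced m T w' := ⟨hw1, congrArg Prod.fst hw', congrArg Prod.snd hw'⟩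
  have hTI' : T ⊆ I := hTI
  have hge := hbal.three_le_card (hTI'.trans hI)
  have hle := hai.card_le_finrank_succ
  rw [Fintype.card_coe, Finset.card_image_of_injOn (hz.mono hTI)] at hle
  have hfin := Submodule.finrank_le (vectorSpan ℝ (Set.range ((↑) : T.image z → ℝ × ℝ)))
  rw [Module.finrank_prod, Module.finrank_self] at hfin
  exact ⟨T, hTI', (mem_centralTriangles_iff_isBalanced hm).2
    ⟨hTI'.trans hI, by omega, w', hw0, hbal⟩⟩

/-- `d` are the coefficients of the unit effect with respect to the `g k`, `k ∈ T`, all of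
them positive, extended by zero to all indices. -/
structure IsUnitWeight (m : ℕ) (T : Finset ℕ) (d : ℕ → ℝ) : Prop where
  pos : ∀ k ∈ T, 0 < d k
  eq_zero : ∀ k, k ∉ T → d k = 0
  sum_eq : ∑ k ∈ T, d k • gVec (2 * m + 1) k = ![0, 0, 1]

theorem IsUnitWeight.nonneg {T : Finset ℕ} {d : ℕ → ℝ} (h : IsUnitWeight m T d) (k : ℕ) :
    0 ≤ d k := by
  by_cases hk : k ∈ T
  · exact (h.pos k hk).le
  · exact (h.eq_zero k hk).ge

theorem IsUnitWeight.sum_of_subset {T I : Finset ℕ} {d : ℕ → ℝ} (h : IsUnitWeight m T d)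
    (hT : T ⊆ I) : ∑ k ∈ I, d k • gVec (2 * m + 1) k = ![0, 0, 1] := by
  rw [← h.sum_eq]
  refine (Finset.sum_subset hT fun k _ hk => ?_).symm
  rw [h.eq_zero k hk, zero_smul]

theorem exists_isUnitWeight (hm : 1 ≤ m) {T : Finset ℕ}
    (hT : T ∈ centralTriangles (2 * m + 1)) : ∃ d, IsUnitWeight m T d := by
  classical
  obtain ⟨hTI, h3, w, hw0, hw⟩ := (mem_centralTriangles_iff_isBalanced hm).1 hT
  have hκ := gFactor_pos hm
  have hpos := hw.pos hTI h3 hw0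
  rw [isBalanced_iff hm, gCenter] at hw
  set κ := 1 / (1 + 1 / cos (π / (2 * m + 1 : ℕ)))
  refine ⟨fun k => if k ∈ T then κ⁻¹ * w k else 0, fun k hk => ?_, fun k hk => if_neg hk, ?_⟩
  · have := hpos k hk
    rw [if_pos hk]
    positivity
  · rw [Finset.sum_congr rfl fun k hk => by rw [if_pos hk, mul_smul], ← Finset.smul_sum, hw,
      smul_smul, inv_mul_cancel₀ hκ.ne', one_smul]

/-- The mixing weights `q` are found by induction on the size of the support of `c`: subtracting the
largest possible multiple of the weights of a central triangle contained in the support of `c` makes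
the support smaller. -/
theorem exists_eq_sum_unitWeight (hm : 1 ≤ m) [Fintype (centralTriangles (2 * m + 1))]
    {d : centralTriangles (2 * m + 1) → ℕ → ℝ}
    (hd : ∀ T : centralTriangles (2 * m + 1), IsUnitWeight m T (d T))
    (c : ℕ → ℝ) (hc : ∀ k ∈ Finset.Icc 1 (2 * m + 1), 0 ≤ c k) (r : ℝ)
    (hsum : ∑ k ∈ Finset.Icc 1 (2 * m + 1), c k • gVec (2 * m + 1) k = r • ![0, 0, 1]) :
    ∃ q : centralTriangles (2 * m + 1) → ℝ, (∀ T, 0 ≤ q T) ∧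
      ∀ k ∈ Finset.Icc 1 (2 * m + 1), c k = ∑ T, q T * d T k := by
  classical
  induction hN : ((Finset.Icc 1 (2 * m + 1)).filter (c · ≠ 0)).card using
    Nat.strong_induction_on generalizing c r with
  | _ N ih =>
    subst hN
    set I := (Finset.Icc 1 (2 * m + 1)).filter (c · ≠ 0) with hIdef
    have hI : I ⊆ Finset.Icc 1 (2 * m + 1) := Finset.filter_subset _ _
    have hcI : ∀ k ∈ I, 0 < c k := fun k hk =>
      lt_of_le_of_ne (hc k (hI hk)) (Finset.mem_filter.1 hk).2.symm
    rcases I.eq_empty_or_nonempty with h0 | hne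
    · refine ⟨0, fun _ => le_rfl, fun k hk => ?_⟩
      by_contra h
      have : k ∈ I := Finset.mem_filter.2 ⟨hk, fun h' => h (by simp [h'])⟩
      simp [h0] at this
    · have hsumI : ∑ k ∈ I, c k • gVec (2 * m + 1) k = r • ![0, 0, 1] := by
        rw [← hsum]
        refine Finset.sum_subset hI fun k hk hkI => ?_
        have : c k = 0 := by
          by_contra h
          exact hkI (Finset.mem_filter.2 ⟨hk, h⟩)
        rw [this, zero_smul]
      have hκ := gFactor_pos hm
      have hr : 0 < r := by
        have h2 := congrFun hsumI 2
        rw [sum_smul_gVec] at h2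
        simp only [Pi.smul_apply, Matrix.cons_val, smul_eq_mul, mul_one] at h2
        rw [← h2]
        exact mul_pos hκ (Finset.sum_pos hcI hne)
      obtain ⟨T, hTI, hT⟩ := (isBalanced_of_sum_smul_gVec hm hr.ne' hsumI).exists_central_subset
        hm hI fun k hk => by
          have := hcI k hk
          positivity
      have hdT := hd ⟨T, hT⟩
      set δ := d ⟨T, hT⟩
      have hTne : T.Nonempty := Finset.card_pos.1 (by rw [hT.2.1]; norm_num)
      obtain ⟨k₀, hk₀, hmin⟩ := T.exists_min_image (fun k => c k / δ k) hTne
      set l := c k₀ / δ k₀ with hl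
      have hl0 : 0 < l := div_pos (hcI k₀ (hTI hk₀)) (hdT.pos k₀ hk₀)
      have hk₀0 : c k₀ - l * δ k₀ = 0 := by
        rw [hl, div_mul_cancel₀ _ (hdT.pos k₀ hk₀).ne', sub_self]
      have hlt : (Finset.Icc 1 (2 * m + 1)).filter (fun k => c k - l * δ k ≠ 0) ⊂ I := by
        refine (Finset.ssubset_iff_of_subset fun k hk => ?_).2 ⟨k₀, hTI hk₀, fun h => ?_⟩
        · obtain ⟨hk1, hk2⟩ := Finset.mem_filter.1 hk
          refine Finset.mem_filter.2 ⟨hk1, fun h0 => hk2 ?_⟩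
          have hkT : k ∉ T := fun hkT => (hcI k (hTI hkT)).ne' h0
          simp only [h0, hdT.eq_zero k hkT, mul_zero, sub_zero]
        · exact (Finset.mem_filter.1 h).2 hk₀0
      have hnn : ∀ k ∈ Finset.Icc 1 (2 * m + 1), 0 ≤ c k - l * δ k := fun k hk => by
        by_cases hkT : k ∈ T
        · have := hmin k hkT
          rw [le_div_iff₀ (hdT.pos k hkT)] at this
          exact sub_nonneg.2 this
        · simp only [hdT.eq_zero k hkT, mul_zero, sub_zero]
          exact hc k hk
      have hsum' : ∑ k ∈ Finset.Icc 1 (2 * m + 1), (c k - l * δ k) • gVec (2 * m + 1) k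
          = (r - l) • ![0, 0, 1] := by
        simp only [sub_smul, mul_smul, Finset.sum_sub_distrib, ← Finset.smul_sum, hsum,
          hdT.sum_of_subset (hTI.trans hI)]
      obtain ⟨q, hq0, hq⟩ := ih _ (Finset.card_lt_card hlt) _ hnn _ hsum' rfl
      refine ⟨q + Pi.single ⟨T, hT⟩ l, fun T' => ?_, fun k hk => ?_⟩
      · have h1 : (0 : centralTriangles (2 * m + 1) → ℝ) ≤ Pi.single ⟨T, hT⟩ l :=
          Pi.single_nonneg.2 hl0.le
        exact add_nonneg (hq0 T') (h1 T')
      · simp only [Pi.add_apply, add_mul, Finset.sum_add_distrib, ← hq k hk, Pi.single_apply,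
          ite_mul, zero_mul, Finset.sum_ite_eq', Finset.mem_univ, if_true]
        ring

/-- Every effect is a nonnegative combination of the `g k`. If the effect `v` attains its minimum
`r` over the vertices at the vertex `i + 1`, then `v - r` is nonnegative at the two neighbouring
vertices and vanishes at `i + 1`, so it is a nonnegative combination of `g (i + 1)` and
`g (i + 2)`, the two of the `g k` that vanish there. -/
theorem IsEffect.exists_eq_sum_gVec (hm : 1 ≤ m) {e : polygon (2 * m + 1) → ℝ}
    (he : IsEffect (polygon (2 * m + 1)) e) : ∃ a : ℕ → ℝ, (∀ k, 0 ≤ a k) ∧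
      e = ∑ k ∈ Finset.Icc 1 (2 * m + 1), a k • dotEffect (2 * m + 1) (gVec (2 * m + 1) k) := by
  classical
  obtain ⟨v, rfl⟩ := he.exists_eq_dotEffect hm
  obtain ⟨j, hj, hmin⟩ := (Finset.Icc 1 (2 * m + 1)).exists_min_image
    (fun k => v ⬝ᵥ polygonVertex (2 * m + 1) k) ⟨1, by simp⟩
  obtain ⟨i, rfl⟩ : ∃ i, j = i + 1 := ⟨j - 1, by have := Finset.mem_Icc.1 hj; omega⟩
  set r := v ⬝ᵥ polygonVertex (2 * m + 1) (i + 1) with hr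
  have hr0 : 0 ≤ r := (he.1 (vertex m (i + 1))).1
  have hmin' : ∀ k, r ≤ v ⬝ᵥ polygonVertex (2 * m + 1) k := fun k => by
    obtain ⟨l, hl, h⟩ := exists_mem_Icc_apply_eq (by omega) (polygonVertex_add
      (n := 2 * m + 1) (by omega)) k
    rw [h]
    exact hmin l hl
  obtain ⟨k', hk', hgk'⟩ := exists_mem_Icc_apply_eq (by omega) (gVec_add
      (n := 2 * m + 1) (by omega)) (i + 2)
  obtain ⟨hp, hq⟩ := gVec_dotProduct_pos hm i
  set P := gVec (2 * m + 1) (i + 1) ⬝ᵥ polygonVertex (2 * m + 1) (i + 2) with hP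
  set Q := gVec (2 * m + 1) (i + 2) ⬝ᵥ polygonVertex (2 * m + 1) i with hQ
  set p := (v ⬝ᵥ polygonVertex (2 * m + 1) (i + 2) - r) / P with hpdef
  set q := (v ⬝ᵥ polygonVertex (2 * m + 1) i - r) / Q with hqdef
  have hp0 : 0 ≤ p := div_nonneg (sub_nonneg.2 (hmin' _)) hp.le
  have hq0 : 0 ≤ q := div_nonneg (sub_nonneg.2 (hmin' _)) hq.le
  have hT : ({1, m + 1, 2 * m + 1} : Finset ℕ) ∈ centralTriangles (2 * m + 1) :=
    (mem_centralTriangles_iff hm).2 ⟨1, m + 1, 2 * m + 1, by omega, by omega, by omega, by omega,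
      by omega, by omega, by omega, rfl⟩
  obtain ⟨d, hd⟩ := exists_isUnitWeight hm hT
  have hv : v = r • ![0, 0, 1] + p • gVec (2 * m + 1) (i + 1) + q • gVec (2 * m + 1) (i + 2) := by
    have hu : ∀ k, ![0, 0, 1] ⬝ᵥ polygonVertex (2 * m + 1) k = 1 := fun k => by
      simp [dotProduct, Fin.sum_univ_three, polygonVertex]
    refine eq_of_dotProduct_polygonVertex_eq hm i fun l => ?_
    simp only [add_dotProduct, smul_dotProduct, hu, smul_eq_mul]
    fin_cases l
    · have h1 := gVec_succ_dotProduct hm i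
      simp only [add_zero, h1, ← hQ]
      rw [hqdef, div_mul_cancel₀ _ hq.ne']
      ring
    · have h1 := gVec_succ_dotProduct hm (i + 1)
      have h2 := gVec_dotProduct_self hm (i + 1)
      simp only [h1, h2, ← hr]
      ring
    · have h1 := gVec_dotProduct_self hm (i + 2)
      simp only [h1, ← hP]
      rw [hpdef, div_mul_cancel₀ _ hp.ne']
      ring
  refine ⟨fun k => r * d k + (if k = i + 1 then p else 0) + (if k = k' then q else 0),
    fun k => ?_, ?_⟩
  · have := hd.nonneg k
    dsimp only
    split_ifs <;> positivity
  · simp only [← dotEffect_smul, ← dotEffect_sum]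
    congr 1
    simp only [add_smul, mul_smul, ite_smul, zero_smul, Finset.sum_add_distrib,
      Finset.sum_ite_eq', hj, hk', if_true, ← Finset.smul_sum, hd.sum_of_subset hT.1]
    rw [← hgk']
    exact hv

/-- The indecomposable effects are multiples of the `g k`. -/
theorem IsIndecomposableEffect.exists_eq_smul_gVec (hm : 1 ≤ m) {e : polygon (2 * m + 1) → ℝ}
    (he : IsIndecomposableEffect (polygon (2 * m + 1)) e) :
    ∃ k ∈ Finset.Icc 1 (2 * m + 1), ∃ c : ℝ,
      e = c • dotEffect (2 * m + 1) (gVec (2 * m + 1) k) := by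
  obtain ⟨a, ha0, ha⟩ := he.1.exists_eq_sum_gVec hm
  obtain ⟨k, hk, hak⟩ : ∃ k ∈ Finset.Icc 1 (2 * m + 1), a k ≠ 0 := by
    by_contra! h
    exact he.2.1 (ha.trans (Finset.sum_eq_zero fun k hk => by rw [h k hk, zero_smul]))
  have hnn : ∀ k s, 0 ≤ (a k • dotEffect (2 * m + 1) (gVec (2 * m + 1) k)) s := fun k s =>
    mul_nonneg (ha0 k) (dotEffect_gVec_nonneg hm k s)
  have hle : a k • dotEffect (2 * m + 1) (gVec (2 * m + 1) k) ≤ e := fun s => by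
    rw [ha, Finset.sum_apply]
    exact Finset.single_le_sum (f := fun k =>
      (a k • dotEffect (2 * m + 1) (gVec (2 * m + 1) k)) s) (fun k _ => hnn k s) hk
  have heff : IsEffect (polygon (2 * m + 1))
      (a k • dotEffect (2 * m + 1) (gVec (2 * m + 1) k)) := by
    rw [← dotEffect_smul]
    refine isEffect_dotEffect fun s => ?_
    rw [dotEffect_smul]
    exact ⟨hnn k s, (hle s).trans (he.1.1 s).2⟩
  obtain ⟨t, ht⟩ := he.eq_smul_of_le heff hle
  have ht0 : t ≠ 0 := by
    rintro rfl
    rw [zero_smul, ← dotEffect_smul] at ht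
    have h0 := dotEffect_injective hm (ht.trans (map_zero (dotLin (2 * m + 1))).symm)
    exact (smul_ne_zero hak (gVec_ne_zero hm k)) h0
  refine ⟨k, hk, t⁻¹ * a k, ?_⟩
  rw [mul_smul, ht, smul_smul, inv_mul_cancel₀ ht0, one_smul]

end Decomposition

/-! ### Observables on the odd polygon -/

section PolygonObservables

open Real

variable {m : ℕ}

theorem eq_of_smul_gVec_eq (hm : 1 ≤ m) {j k : ℕ} (hj : j ∈ Finset.Icc 1 (2 * m + 1))
    (hk : k ∈ Finset.Icc 1 (2 * m + 1)) {a b : ℝ} (ha : a ≠ 0)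
    (h : a • dotEffect (2 * m + 1) (gVec (2 * m + 1) j)
      = b • dotEffect (2 * m + 1) (gVec (2 * m + 1) k)) : j = k := by
  rw [← dotEffect_smul, ← dotEffect_smul] at h
  have hκ := (gFactor_pos hm).ne'
  have h' := dotEffect_injective hm h
  have h0 := congrFun h' 0
  have h1 := congrFun h' 1
  have h2 := congrFun h' 2
  simp only [gVec, Pi.smul_apply, smul_eq_mul, Matrix.cons_val_zero, Matrix.cons_val_one,
    Matrix.cons_val, mul_one] at h0 h1 h2
  obtain rfl := mul_right_cancel₀ hκ h2
  exact eq_of_cos_eq_of_sin_eq hj hk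
    (neg_injective (mul_left_cancel₀ hκ (mul_left_cancel₀ ha h0)))
    (neg_injective (mul_left_cancel₀ hκ (mul_left_cancel₀ ha h1)))

namespace IsSupportedOn

variable {A A' : Observable (polygon (2 * m + 1))} {T T' : Finset ℕ}

theorem card_outcome (hA : IsSupportedOn A T) : Fintype.card A.Outcome = T.card := by
  obtain ⟨k, -, -⟩ := hA
  rw [Fintype.card_congr k, Fintype.card_coe]

theorem linearIndependent (hT : T ∈ centralTriangles (2 * m + 1)) (hm : 1 ≤ m)
    (hA : IsSupportedOn A T) : LinearIndependent ℝ A.effect := by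
  obtain ⟨k, c, hc⟩ := hA
  have h1 := (linearIndependent_gVec hT.1 hT.2.1).comp k k.injective
  have h2 := (h1.map' (dotLin (2 * m + 1)) (LinearMap.ker_eq_bot.2 (dotEffect_injective hm)))
  have h3 := h2.units_smul fun x => Units.mk0 (c x) (hc x).1.ne'
  rw [show A.effect = _ from funext fun x => (hc x).2]
  exact h3

theorem isIndecomposable (hT : T ∈ centralTriangles (2 * m + 1)) (hm : 1 ≤ m)
    (hA : IsSupportedOn A T) : A.IsIndecomposable := by
  obtain ⟨k, c, hc⟩ := hA
  intro x _
  have h := A.isEffect x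
  rw [(hc x).2] at h ⊢
  exact isIndecomposableEffect_smul_gVec hm (Finset.mem_Icc.1 (hT.1 (k x).2)).1 (hc x).1 h

theorem isSimIrreducible (hT : T ∈ centralTriangles (2 * m + 1)) (hm : 1 ≤ m)
    (hA : IsSupportedOn A T) : A.IsSimIrreducible :=
  A.isSimIrreducible_of_linearIndependent (hA.isIndecomposable hT hm)
    (hA.linearIndependent hT hm)

theorem exists_isUnitWeight (hm : 1 ≤ m) (hA : IsSupportedOn A T) :
    ∃ (e : A.Outcome ≃ T) (d : ℕ → ℝ), IsUnitWeight m T d ∧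
      ∀ x, A.effect x = d (e x) • dotEffect (2 * m + 1) (gVec (2 * m + 1) (e x)) := by
  classical
  obtain ⟨e, c, hc⟩ := hA
  let d : ℕ → ℝ := fun k => if h : k ∈ T then c (e.symm ⟨k, h⟩) else 0
  have hd : ∀ x, d (e x) = c x := fun x => by simp [d]
  refine ⟨e, d, ⟨fun k hk => ?_, fun k hk => dif_neg hk, ?_⟩, fun x => by rw [hd, (hc x).2]⟩
  · simp only [d, dif_pos hk]
    exact (hc _).1
  · apply dotEffect_injective hm
    rw [dotEffect_unit, ← A.sum_effect, dotEffect_sum, ← Finset.sum_coe_sort, ← e.sum_comp]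
    exact Finset.sum_congr rfl fun x _ => by rw [dotEffect_smul, hd, (hc x).2]

theorem postprocessesTo (hT : T ∈ centralTriangles (2 * m + 1)) (hm : 1 ≤ m)
    (hA : IsSupportedOn A T) (hA' : IsSupportedOn A' T) : A.PostprocessesTo A' := by
  have hli := hA.linearIndependent hT hm
  obtain ⟨k, c, hc⟩ := hA
  obtain ⟨k', c', hc'⟩ := hA'
  let f : A.Outcome ≃ A'.Outcome := k.trans k'.symm
  have hf : ∀ x, A'.effect (f x) = (c' (f x) / c x) • A.effect x := fun x => by
    rw [(hc' (f x)).2, (hc x).2, smul_smul, div_mul_cancel₀ _ (hc x).1.ne']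
    simp [f]
  have h0 : ∑ x, (c' (f x) / c x - 1) • A.effect x = 0 := by
    simp only [sub_smul, one_smul, ← hf, Finset.sum_sub_distrib, A.sum_effect]
    rw [f.sum_comp A'.effect, A'.sum_effect, sub_self]
  refine Observable.PostprocessesTo.of_equiv f fun x => ?_
  rw [hf, sub_eq_zero.1 (Fintype.linearIndependent_iff.1 hli _ h0 x), one_smul]

theorem postEquiv_iff (hT : T ∈ centralTriangles (2 * m + 1))
    (hT' : T' ∈ centralTriangles (2 * m + 1)) (hm : 1 ≤ m) (hA : IsSupportedOn A T)
    (hA' : IsSupportedOn A' T') : A.PostEquiv A' ↔ T = T' := by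
  constructor
  · intro h
    obtain ⟨f, b, -, hb⟩ := h.exists_injective_of_linearIndependent (hA'.linearIndependent hT' hm)
    obtain ⟨k, c, hc⟩ := hA
    obtain ⟨k', c', hc'⟩ := hA'
    refine (Finset.eq_of_subset_of_card_le (fun j hj => ?_) (by rw [hT.2.1, hT'.2.1])).symm
    obtain ⟨x, hx⟩ := k'.surjective ⟨j, hj⟩
    have h1 := (hb x).2
    rw [(hc _).2, (hc' x).2, smul_smul, hx] at h1
    rw [← eq_of_smul_gVec_eq hm (hT.1 (k (f x)).2) (hT'.1 hj) (hc _).1.ne' h1]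
    exact (k (f x)).2
  · rintro rfl
    exact ⟨hA.postprocessesTo hT hm hA', hA'.postprocessesTo hT hm hA⟩

end IsSupportedOn

theorem exists_isSupportedOn (hm : 1 ≤ m) {T : Finset ℕ}
    (hT : T ∈ centralTriangles (2 * m + 1)) :
    ∃ A : Observable (polygon (2 * m + 1)), IsSupportedOn A T := by
  obtain ⟨d, hd⟩ := exists_isUnitWeight hm hT
  have hsum : ∑ k : T, d k • dotEffect (2 * m + 1) (gVec (2 * m + 1) k) = 1 := by
    rw [Finset.sum_coe_sort T fun k => d k • dotEffect (2 * m + 1) (gVec (2 * m + 1) k),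
      ← dotEffect_unit, ← hd.sum_eq, dotEffect_sum]
    simp only [dotEffect_smul]
  have hnn : ∀ (k : ℕ) s, 0 ≤ (d k • dotEffect (2 * m + 1) (gVec (2 * m + 1) k)) s := fun k s =>
    mul_nonneg (hd.nonneg k) (dotEffect_gVec_nonneg hm k s)
  refine ⟨{ Outcome := T
            effect := fun k => d k • dotEffect (2 * m + 1) (gVec (2 * m + 1) k)
            isEffect := fun k => ?_
            sum_effect := hsum }, Equiv.refl _, fun k => d (k : T), fun k => ⟨hd.pos _ k.2, rfl⟩⟩
  rw [← dotEffect_smul]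
  refine isEffect_dotEffect fun s => ?_
  rw [dotEffect_smul]
  refine ⟨hnn k s, ?_⟩
  have h1 := congrFun hsum s
  rw [Finset.sum_apply, Pi.one_apply] at h1
  rw [← h1]
  exact Finset.single_le_sum (f := fun k : T =>
    (d k • dotEffect (2 * m + 1) (gVec (2 * m + 1) k)) s) (fun k _ => hnn k s) (Finset.mem_univ k)

/-- Observables supported on the central triangles, one for each, simulate everything. The effects
of `A` are nonnegative combinations `∑ k, a y k • g k`; hence `A` is a postprocessing, by the matrix
`a y k / c k`, of the observable with the effects `c k • g k`, `c k = ∑ y, a y k`, and this one is a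
mixture of the given observables. -/
theorem mem_sim_range (hm : 1 ≤ m)
    {B : centralTriangles (2 * m + 1) → Observable (polygon (2 * m + 1))}
    (hB : ∀ T : centralTriangles (2 * m + 1), IsSupportedOn (B T) T)
    (A : Observable (polygon (2 * m + 1))) : A ∈ Observable.sim (Set.range B) := by
  classical
  have hfin : (centralTriangles (2 * m + 1)).Finite :=
    (Finset.Icc 1 (2 * m + 1)).powerset.finite_toSet.subset fun T hT =>
      Finset.mem_coe.2 (Finset.mem_powerset.2 hT.1)
  have : Fintype (centralTriangles (2 * m + 1)) := hfin.fintype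
  set G : ℕ → polygon (2 * m + 1) → ℝ := fun k => dotEffect (2 * m + 1) (gVec (2 * m + 1) k)
   
  choose e d hd he using fun T => (hB T).exists_isUnitWeight hm
  choose a ha0 ha using fun y => (A.isEffect y).exists_eq_sum_gVec hm
  let c : ℕ → ℝ := fun k => ∑ y, a y k
  have hc0 : ∀ k, 0 ≤ c k := fun k => Finset.sum_nonneg fun y _ => ha0 y k
  have hac : ∀ y k, a y k ≤ c k := fun y k =>
    Finset.single_le_sum (f := fun y => a y k) (fun y _ => ha0 y k) (Finset.mem_univ y)
  have hcsum : ∑ k ∈ Finset.Icc 1 (2 * m + 1), c k • gVec (2 * m + 1) k = ![0, 0, 1] := by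
    apply dotEffect_injective hm
    rw [dotEffect_unit, ← A.sum_effect, Finset.sum_congr rfl fun y _ => ha y, Finset.sum_comm,
      dotEffect_sum]
    exact Finset.sum_congr rfl fun k _ => by rw [dotEffect_smul, ← Finset.sum_smul]
  obtain ⟨q, hq0, hq⟩ := exists_eq_sum_unitWeight hm hd c (fun k _ => hc0 k) 1
    (by rw [hcsum, one_smul])
  have hq1 : ∑ T, q T = 1 := by
    have h1 : ∑ k ∈ Finset.Icc 1 (2 * m + 1), c k • gVec (2 * m + 1) k
        = (∑ T, q T) • ![0, 0, 1] := by
      rw [Finset.sum_congr rfl fun k hk => by rw [hq k hk, Finset.sum_smul], Finset.sum_comm,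
        Finset.sum_smul]
      refine Finset.sum_congr rfl fun T _ => ?_
      simp only [mul_smul, ← Finset.smul_sum, (hd T).sum_of_subset T.2.1]
    rw [hcsum] at h1
    simpa using (congrFun h1 2).symm
  obtain ⟨y₀⟩ : Nonempty A.Outcome := by
    by_contra h
    rw [not_nonempty_iff] at h
    have := congrFun A.sum_effect (vertex m 0)
    simp at this
  -- where `c k = 0` the outcome may be chosen arbitrarily
  let ν : ℕ → A.Outcome → ℝ := fun k y =>
    if c k = 0 then (if y = y₀ then 1 else 0) else a y k / c k
  have hν : ∀ k, (∀ y, 0 ≤ ν k y ∧ ν k y ≤ 1) ∧ ∑ y, ν k y = 1 := fun k => by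
    by_cases h : c k = 0
    · refine ⟨fun y => ?_, by simp [ν, h]⟩
      simp only [ν, h, if_true]
      split_ifs <;> norm_num
    · have hpos : 0 < c k := lt_of_le_of_ne (hc0 k) (Ne.symm h)
      refine ⟨fun y => ?_, ?_⟩
      · simp only [ν, h, if_false]
        exact ⟨div_nonneg (ha0 y k) hpos.le, (div_le_one hpos).2 (hac y k)⟩
      · simp only [ν, h, if_false]
        rw [← Finset.sum_div]
        exact div_self h
  have hνc : ∀ k y, ν k y * c k = a y k := fun k y => by
    by_cases h : c k = 0
    · rw [h, mul_zero]
      exact le_antisymm (ha0 y k) (h ▸ hac y k)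
    · simp only [ν, h, if_false]
      exact div_mul_cancel₀ _ h
  let i := (Fintype.equivFin (centralTriangles (2 * m + 1))).symm
  refine ⟨_, fun j => B (i j), fun j => q (i j), fun x y => ν (e (i x.1) x.2) y,
    fun j => ⟨_, rfl⟩, fun j => hq0 _, by rw [i.sum_comp q, hq1],
    ⟨fun x y => (hν _).1 y, fun x => (hν _).2⟩, fun y => ?_⟩
  dsimp only
  rw [i.sum_comp fun T => ∑ x, (ν (e T x) y * q T) • (B T).effect x]
  have hT : ∀ T, ∑ x, (ν (e T x) y * q T) • (B T).effect x
      = ∑ k ∈ Finset.Icc 1 (2 * m + 1), (ν k y * (q T * d T k)) • G k := fun T => by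
    rw [← Finset.sum_subset T.2.1 fun k _ hk => by
      rw [(hd T).eq_zero k hk, mul_zero, mul_zero, zero_smul],
      ← Finset.sum_coe_sort T.1 fun k => (ν k y * (q T * d T k)) • G k,
      ← (e T).sum_comp]
    refine Finset.sum_congr rfl fun x _ => ?_
    rw [he, smul_smul, mul_assoc]
  rw [Finset.sum_congr rfl fun T _ => hT T, Finset.sum_comm, ha y]
  refine Finset.sum_congr rfl fun k hk => ?_
  rw [← Finset.sum_smul, ← Finset.mul_sum, ← hq k hk, hνc]

theorem exists_isSupportedOn_of_isSimIrreducible (hm : 1 ≤ m)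
    {A : Observable (polygon (2 * m + 1))} (h3 : Fintype.card A.Outcome = 3)
    (hA : A.IsSimIrreducible) : ∃ T ∈ centralTriangles (2 * m + 1), IsSupportedOn A T := by
  choose B hB using fun T : centralTriangles (2 * m + 1) => exists_isSupportedOn hm T.2
  obtain ⟨_, ⟨T, rfl⟩, hT⟩ := hA _ (mem_sim_range hm hB A)
  obtain ⟨f, b, hf, hb⟩ := hT.exists_injective_of_linearIndependent
    ((hB T).linearIndependent T.2 hm)
  have hcard : Fintype.card (B T).Outcome = Fintype.card A.Outcome := by
    rw [(hB T).card_outcome, T.2.2.1, h3]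
  let g := Equiv.ofBijective f ((Fintype.bijective_iff_injective_and_card f).2 ⟨hf, hcard⟩)
  obtain ⟨k, c, hc⟩ := hB T
  refine ⟨T, T.2, g.symm.trans k, fun y => b (g.symm y) * c (g.symm y), fun y => ?_⟩
  obtain ⟨x, rfl⟩ := g.surjective y
  simp only [Equiv.symm_apply_apply, Equiv.trans_apply]
  refine ⟨mul_pos (hb x).1 (hc x).1, ?_⟩
  rw [mul_smul, ← (hc x).2]
  exact (hb x).2

/-- The effects of an indecomposable observable are multiples of the `g k`, and no combination of
two of the `g k` is the unit effect. -/
theorem not_isIndecomposable_of_card_eq_two (hm : 1 ≤ m)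
    {A : Observable (polygon (2 * m + 1))} (h2 : Fintype.card A.Outcome = 2) :
    ¬ A.IsIndecomposable := by
  classical
  intro hA
  have key : ∀ x, ∃ k ∈ Finset.Icc 1 (2 * m + 1), ∃ c : ℝ,
      A.effect x = c • dotEffect (2 * m + 1) (gVec (2 * m + 1) k) := fun x => by
    by_cases h : A.effect x = 0
    · exact ⟨1, by simp, 0, by rw [h, zero_smul]⟩
    · exact (hA x h).exists_eq_smul_gVec hm
  choose k hk c hc using key
  let T := Finset.univ.image k
  have hsum : ∑ j ∈ T, (∑ x with k x = j, c x) • gVec (2 * m + 1) j = (1 : ℝ) • ![0, 0, 1] := by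
    rw [one_smul]
    apply dotEffect_injective hm
    rw [dotEffect_unit, ← A.sum_effect,
      ← Finset.sum_fiberwise_of_maps_to (t := T) (g := k) fun x hx =>
        Finset.mem_image_of_mem k hx, dotEffect_sum]
    refine Finset.sum_congr rfl fun j _ => ?_
    rw [dotEffect_smul, Finset.sum_smul]
    refine Finset.sum_congr rfl fun x hx => ?_
    rw [hc, (Finset.mem_filter.1 hx).2]
  have hT : T ⊆ Finset.Icc 1 (2 * m + 1) := Finset.image_subset_iff.2 fun x _ => hk x
  have h3 := (isBalanced_of_sum_smul_gVec hm one_ne_zero hsum).three_le_card hT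
  have h4 : T.card ≤ Fintype.card A.Outcome := Finset.card_image_le
  omega

/-- Observables supported on the central triangles are irreducible and inequivalent, so each has an
equivalent one in every set that simulates all observables; conversely they simulate all of them. -/
theorem minSimNumber_univ (hm : 1 ≤ m) :
    Observable.minSimNumber (Set.univ : Set (Observable (polygon (2 * m + 1))))
      = (centralTriangles (2 * m + 1)).encard := by
  choose B hB using fun T : centralTriangles (2 * m + 1) => exists_isSupportedOn hm T.2
  apply le_antisymm
  · refine (iInf₂_le (Set.range B) fun A _ => mem_sim_range hm hB A).trans ?_
    rw [← Set.image_univ]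
    exact (Set.encard_image_le _ _).trans (Set.encard_univ _).le
  · refine le_iInf₂ fun 𝓑 h𝓑 => ?_
    choose C hC hBC using fun T : centralTriangles (2 * m + 1) =>
      (hB T).isSimIrreducible T.2 hm 𝓑 (h𝓑 (Set.mem_univ _))
    have hinj : Function.Injective C := fun T T' h => by
      have h1 := hBC T
      have h2 := hBC T'
      rw [← h] at h2
      exact Subtype.ext (((hB T).postEquiv_iff T.2 T'.2 hm (hB T')).1
        ⟨h1.1.trans h2.2, h2.1.trans h1.2⟩)
    refine hinj.encard_range.trans ?_
    exact Set.encard_le_encard (Set.range_subset_iff.2 hC)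

theorem isSimIrreducible_iff_exists_isSupportedOn (hm : 1 ≤ m)
    {A : Observable (polygon (2 * m + 1))} (h3 : Fintype.card A.Outcome = 3) :
    A.IsSimIrreducible ↔ ∃ T ∈ centralTriangles (2 * m + 1), IsSupportedOn A T :=
  ⟨exists_isSupportedOn_of_isSimIrreducible hm h3,
    fun ⟨_, hT, hA⟩ => hA.isSimIrreducible hT hm⟩

theorem numInequivalent_trichotomic (hm : 1 ≤ m) :
    Observable.numInequivalent {A : Observable (polygon (2 * m + 1)) |
      Fintype.card A.Outcome = 3 ∧ A.IsSimIrreducible}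
      = (centralTriangles (2 * m + 1)).encard := by
  choose B hB using fun T : centralTriangles (2 * m + 1) => exists_isSupportedOn hm T.2
  let φ : centralTriangles (2 * m + 1) →
      Quotient (Observable.postSetoid (polygon (2 * m + 1))) := fun T => Quotient.mk _ (B T)
  have hinj : Function.Injective φ := fun T T' h => Subtype.ext
    (((hB T).postEquiv_iff T.2 T'.2 hm (hB T')).1 (Quotient.exact h))
  rw [Observable.numInequivalent, ← ENat.card_coe_set_eq (centralTriangles (2 * m + 1)),
    ← Set.encard_univ, ← hinj.encard_image, Set.image_univ]
  congr 1
  ext Q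
  constructor
  · rintro ⟨A, ⟨h3, hA⟩, rfl⟩
    obtain ⟨T, hT, hAT⟩ := exists_isSupportedOn_of_isSimIrreducible hm h3 hA
    exact ⟨⟨T, hT⟩, Quotient.sound (((hB ⟨T, hT⟩).postEquiv_iff hT hT hm hAT).2 rfl)⟩
  · rintro ⟨T, rfl⟩
    exact ⟨B T, ⟨by rw [(hB T).card_outcome, T.2.2.1], (hB T).isSimIrreducible T.2 hm⟩, rfl⟩

end PolygonObservables

end GPT

theorem mainTheorem7 (m : ℕ) (hm : 1 ≤ m) :
    -- the minimal simulation number of the set of all observables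
    6 * GPT.Observable.minSimNumber
        (Set.univ : Set (GPT.Observable (GPT.polygon (2 * m + 1))))
      = ((m * (m + 1) * (2 * m + 1) : ℕ) : ℕ∞) ∧
    -- there are no indecomposable dichotomic observables
    (∀ A : GPT.Observable (GPT.polygon (2 * m + 1)),
      Fintype.card A.Outcome = 2 → ¬ A.IsIndecomposable) ∧
    -- the trichotomic simulation irreducible observables are those supported on the triangles
    -- that contain the center
    (∀ A : GPT.Observable (GPT.polygon (2 * m + 1)), Fintype.card A.Outcome = 3 →
      (A.IsSimIrreducible ↔
        ∃ T ∈ GPT.centralTriangles (2 * m + 1), GPT.IsSupportedOn A T)) ∧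
    -- every such triangle occurs
    (∀ T ∈ GPT.centralTriangles (2 * m + 1),
      ∃ A : GPT.Observable (GPT.polygon (2 * m + 1)), GPT.IsSupportedOn A T) ∧
    -- two such observables are equivalent exactly when the triangles agree
    (∀ T ∈ GPT.centralTriangles (2 * m + 1), ∀ T' ∈ GPT.centralTriangles (2 * m + 1),
      ∀ A A' : GPT.Observable (GPT.polygon (2 * m + 1)),
        GPT.IsSupportedOn A T → GPT.IsSupportedOn A' T' → (A.PostEquiv A' ↔ T = T')) ∧
    -- the number of these triangles, and hence of the inequivalent trichotomic simulation
    -- irreducible observables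
    6 * (GPT.centralTriangles (2 * m + 1)).encard
      = ((m * (m + 1) * (2 * m + 1) : ℕ) : ℕ∞) ∧
    6 * GPT.Observable.numInequivalent
        {A : GPT.Observable (GPT.polygon (2 * m + 1)) |
          Fintype.card A.Outcome = 3 ∧ A.IsSimIrreducible}
      = ((m * (m + 1) * (2 * m + 1) : ℕ) : ℕ∞) := by
  refine ⟨?_, fun A h2 => GPT.not_isIndecomposable_of_card_eq_two hm h2,
    fun A h3 => GPT.isSimIrreducible_iff_exists_isSupportedOn hm h3,
    fun T hT => GPT.exists_isSupportedOn hm hT,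
    fun T hT T' hT' A A' hA hA' => hA.postEquiv_iff hT hT' hm hA',
    GPT.encard_centralTriangles hm, ?_⟩
  · rw [GPT.minSimNumber_univ hm, GPT.encard_centralTriangles hm]
  · rw [GPT.numInequivalent_trichotomic hm, GPT.encard_centralTriangles hm]
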